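/- Let $d,k,r\in\mathbb N=\{0,1,2,\dots\}$. For $M\in\mathbb N$ let $\mathrm{Comp}_{\ge r}(M)$ be the set of tuples $m=(m_1,\dots,m_\ell)$ of natural numbers, $\ell\ge 1$, with $m_i\ge r$ for all $i$ and $m_1+\dots+m_\ell=M$. For $m\in\mathrm{Comp}_{\ge r}(M)$, a *geometric $m$-spline of regularity $r$* in $\mathbb R^d$ is a continuous path $X:[0,1]\to\mathbb R^d$ of the form $X(t)=X^{[i]}\bigl(t-\tfrac{i-1}{\ell}\bigr)$ for $t\in[\tfrac{i-1}\ell,\tfrac i\ell]$, $1\le i\le \ell$, where each $X^{[i]}$ is a polynomial path whose coordinates have degree at most $m_i$, such that for all $1\le i\le \ell-1$ and $1\le s\le r$ there is $\rho_{i,s}>0$ with $$\rho_{i,s}\,\frac{\mathrm d^sX^{[i]}}{\mathrm dt^s}\Bigl(\frac1\ell\Bigr)=\frac{\mathrm d^sX^{[i+1]}}{\mathrm dt^s}(0).$$ It is a *parametric $m$-spline of regularity $r$* if this holds with $\rho_{i,s}=1$ for all $i,s$. The $k$-truncated signature of such a path is $\sigma^{\le k}(X)\in T^{\le k}(\mathbb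 R^d)=\bigoplus_{j=0}^k(\mathbb R^d)^{\otimes j}$, with entries $$\sigma(X)_{i_1\dots i_j}=\int_0^1\int_0^{t_j}\cdots\int_0^{t_2}\dot X_{i_1}(t_1)\cdots\dot X_{i_j}(t_j)\,\mathrm dt_1\cdots\mathrm dt_j$$ for $j\le k$ (and entry $1$ in degree $0$). Let $\mathcal S^r_{d,\le k,m}$ and $\mathcal P^r_{d,\le k,m}$ be the Zariski closures in $T^{\le k}(\mathbb C^d)$ of the sets of signatures $\sigma^{\le k}(X)$ of all geometric, respectively parametric, $m$-splines $X$ of regularity $r$ in $\mathbb R^d$. Let $\mathcal G^{\le k}(\mathbb C^d)=\exp(\mathfrak g)\subseteq T^{\le k}(\mathbb C^d)$ be the free $k$-step nilpotent group over $\mathbb C$, where $\mathfrak g$ is the Lie subalgebra of the truncated tensor algebra $T^{\le k}(\mathbb C^d)$ generated by $\mathbb C^d$; this is the complex variety defined by the real group $\mathcal G^{\le k}(\mathbb R^d)$. Then: 1. For all $d,k,r,M\in\mathbb N$ and all $m\in\mathrm{Comp}_{\ge r}(M)$, the varieties $\mathcal P^r_{d,\le k,m}$ and $\mathcal S^r_{d,\le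 k,m}$ are irreducible. 2. For all $d,k,r\in\mathbb N$ there is $N\in\mathbb N$ such that for all $M\ge N$ and all $m\in\mathrm{Comp}_{\ge r+1}(M)$, $$\mathcal P^r_{d,\le k,m}=\mathcal S^r_{d,\le k,m}=\mathcal G^{\le k}(\mathbb C^d).$$ -/

import Mathlib

noncomputable section

attribute [local instance] LieRing.ofAssociativeRing

/-! ### Truncated tensors and the free nilpotent group -/

/-- Words of length at most `k` over the alphabet with `d` letters. -/
abbrev TruncWord (d k : ℕ) : Type := {w : List (Fin d) // w.length ≤ k}

/-- The truncated tensor space `T^{≤k}(K^d) = ⨁_{j ≤ k} (K^d)^{⊗ j}`: the coordinate at the word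
`i₁ … i_j` is the coefficient of `e_{i₁} ⊗ ⋯ ⊗ e_{i_j}`. -/
abbrev TruncTensor (K : Type*) (d k : ℕ) : Type _ := TruncWord d k → K

/-- The tensor algebra `T(K^d)`, realized as the algebra of noncommutative polynomials in `d`
letters; the product is concatenation of words. -/
abbrev TensorAlg (K : Type*) [Field K] (d : ℕ) : Type _ := MonoidAlgebra K (FreeMonoid (Fin d))

/-- The letter `i`, i.e. the basis vector `e_i` of `K^d` in the tensor algebra. -/
def TensorAlg.letter (K : Type*) [Field K] {d : ℕ} (i : Fin d) : TensorAlg K d :=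
  MonoidAlgebra.of K (FreeMonoid (Fin d)) (FreeMonoid.of i)

/-- The projection `T(K^d) → T^{≤k}(K^d)` that forgets all components of degree `> k`. -/
def TensorAlg.trunc {K : Type*} [Field K] {d : ℕ} (k : ℕ) (p : TensorAlg K d) :
    TruncTensor K d k :=
  fun w => p.coeff (FreeMonoid.ofList w.1)

/-- The free Lie algebra: the Lie subalgebra of `T(K^d)` (with the commutator bracket) that is
generated by the letters. Its image in `T^{≤k}(K^d)` is the free `k`-step nilpotent Lie algebra. -/
def freeLie (K : Type*) [Field K] (d : ℕ) : LieSubalgebra K (TensorAlg K d) :=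
  LieSubalgebra.lieSpan K (TensorAlg K d) (Set.range (TensorAlg.letter K))

/-- The exponential series up to order `k`. On elements without constant term, its
truncation at level `k` is the exponential in the truncated tensor algebra `T^{≤k}(K^d)`. -/
def expSum {K : Type*} [Field K] {d : ℕ} (k : ℕ) (p : TensorAlg K d) : TensorAlg K d :=
  ∑ n ∈ Finset.range (k + 1), ((n.factorial : K)⁻¹) • p ^ n

/-- The free `k`-step nilpotent group `G^{≤k}(K^d) ⊆ T^{≤k}(K^d)`: the exponential image of the
free `k`-step nilpotent Lie algebra. -/
def freeNilpotentGroup (K : Type*) [Field K] (d k : ℕ) : Set (TruncTensor K d k) :=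
  {x | ∃ p ∈ freeLie K d, x = TensorAlg.trunc k (expSum k p)}

/-! ### Zariski topology on a complex affine space -/

/-- The Zariski topology on the affine space `ℂ^σ`: the closed sets are the common zero sets of
families of polynomials. -/
@[reducible] def zariskiTopology (σ : Type*) : TopologicalSpace (σ → ℂ) :=
  TopologicalSpace.ofClosed
    {V | ∃ F : Set (MvPolynomial σ ℂ), V = {x | ∀ f ∈ F, MvPolynomial.eval x f = 0}}
    ⟨{1}, by ext x; simp⟩
    (by
      intro A hA
      refine ⟨{f | ∃ V ∈ A, ∀ x ∈ V, MvPolynomial.eval x f = 0}, ?_⟩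
      ext x
      constructor
      · rintro hx f ⟨V, hV, hf⟩
        exact hf x (hx V hV)
      · intro hx V hV
        obtain ⟨F, rfl⟩ := hA hV
        intro f hf
        exact hx f ⟨_, hV, fun y hy => hy f hf⟩)
    (by
      rintro V ⟨F, rfl⟩ W ⟨G, rfl⟩
      refine ⟨{h | ∃ f ∈ F, ∃ g ∈ G, h = f * g}, ?_⟩
      ext x
      constructor
      · rintro (hx | hx) h ⟨f, hf, g, hg, rfl⟩
        · simp [hx f hf]
        · simp [hx g hg]
      · intro hx
        by_contra hcon
        simp only [Set.mem_union, Set.mem_ofPred_eq, not_or, not_forall] at hcon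
        obtain ⟨⟨f, hf, hfx⟩, ⟨g, hg, hgx⟩⟩ := hcon
        have h := hx (f * g) ⟨f, hf, g, hg, rfl⟩
        rw [map_mul] at h
        exact (mul_ne_zero hfx hgx) h)

/-- The Zariski closure of a subset of `ℂ^σ`. -/
def zariskiClosure {σ : Type*} (S : Set (σ → ℂ)) : Set (σ → ℂ) :=
  @closure (σ → ℂ) (zariskiTopology σ) S

/-- Irreducibility of a subset of `ℂ^σ` in the Zariski topology. -/
def IsZariskiIrreducible {σ : Type*} (S : Set (σ → ℂ)) : Prop :=
  @IsIrreducible (σ → ℂ) (zariskiTopology σ) S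

/-! ### Signatures of paths -/

/-- Iterated integrals of a path `X`, with the word read from the outermost (last) letter to the
innermost (first) one: `iterInt X (i_j :: ⋯ :: i_1 :: []) t` is
`∫_0^t ∫_0^{t_j} ⋯ ∫_0^{t_2} X'_{i_1}(t_1) ⋯ X'_{i_j}(t_j) dt_1 ⋯ dt_j`. -/
def iterInt {d : ℕ} (X : ℝ → Fin d → ℝ) : List (Fin d) → ℝ → ℝ
  | [], _ => 1
  | i :: u, t => ∫ s in (0 : ℝ)..t, iterInt X u s * deriv (fun τ => X τ i) s

/-- The `k`-truncated iterated-integrals signature of a path on `[0,1]`. -/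
def pathSignature {d : ℕ} (k : ℕ) (X : ℝ → Fin d → ℝ) : TruncTensor ℝ d k :=
  fun w => iterInt X w.1.reverse 1

/-! ### Splines -/

/-- `m = (m_1, …, m_ℓ)`, of length `ℓ ≥ 1`, is a composition of `M` with all entries `≥ r`. -/
def IsCompGE (r M : ℕ) {ℓ : ℕ} (m : Fin ℓ → ℕ) : Prop :=
  0 < ℓ ∧ (∀ i, r ≤ m i) ∧ ∑ i, m i = M

/-- On `[0,1]`, the path `X` is the concatenation of the polynomial paths
`p 0, …, p (ℓ - 1) : [0, 1/ℓ] → ℝ^d`, where the constant terms of the `p i` are normalized such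
that no translation is needed: `X t = p i (t - i/ℓ)` for `t ∈ [i/ℓ, (i+1)/ℓ]`. Both
neighbouring conditions hold at a control point, so `X` is continuous on `[0,1]`. Only the values
of `X` on `[0,1]` matter. -/
def IsPiecewisePolynomial {d ℓ : ℕ} (p : Fin ℓ → Fin d → Polynomial ℝ) (X : ℝ → Fin d → ℝ) :
    Prop :=
  ∀ i : Fin ℓ, ∀ t ∈ Set.Icc ((i : ℝ) / ℓ) (((i : ℝ) + 1) / ℓ), ∀ j : Fin d,
    X t j = (p i j).eval (t - (i : ℝ) / ℓ)

/-- Geometric `m`-splines of regularity `r` in `ℝ^d`: at every inner control point and for every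
`1 ≤ s ≤ r`, the `s`-th derivatives of the two adjacent pieces agree up to a positive factor
`ρ` depending on the control point and on `s`. -/
def IsGeometricSpline {d ℓ : ℕ} (r : ℕ) (m : Fin ℓ → ℕ) (X : ℝ → Fin d → ℝ) : Prop :=
  ∃ p : Fin ℓ → Fin d → Polynomial ℝ,
    IsPiecewisePolynomial p X ∧
    (∀ i j, (p i j).natDegree ≤ m i) ∧
    ∀ i i' : Fin ℓ, (i' : ℕ) = i + 1 → ∀ s : ℕ, 1 ≤ s → s ≤ r →
      ∃ ρ : ℝ, 0 < ρ ∧ ∀ j : Fin d,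
        ρ * (Polynomial.derivative^[s] (p i j)).eval (1 / (ℓ : ℝ)) =
          (Polynomial.derivative^[s] (p i' j)).eval 0

/-- Parametric `m`-splines of regularity `r` in `ℝ^d`: at every inner control point the
derivatives of order `1 ≤ s ≤ r` of the two adjacent pieces agree. -/
def IsParametricSpline {d ℓ : ℕ} (r : ℕ) (m : Fin ℓ → ℕ) (X : ℝ → Fin d → ℝ) : Prop :=
  ∃ p : Fin ℓ → Fin d → Polynomial ℝ,
    IsPiecewisePolynomial p X ∧
    (∀ i j, (p i j).natDegree ≤ m i) ∧
    ∀ i i' : Fin ℓ, (i' : ℕ) = i + 1 → ∀ s : ℕ, 1 ≤ s → s ≤ r → ∀ j : Fin d,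
      (Polynomial.derivative^[s] (p i j)).eval (1 / (ℓ : ℝ)) =
        (Polynomial.derivative^[s] (p i' j)).eval 0

/-! ### Signature varieties -/

/-- A real truncated tensor, viewed as a complex one. -/
def complexify {d k : ℕ} (x : TruncTensor ℝ d k) : TruncTensor ℂ d k := fun w => (x w : ℂ)

/-- The signature variety `S^r_{d,≤k,m}` of geometric splines. -/
def geomSplineVariety (d k r : ℕ) {ℓ : ℕ} (m : Fin ℓ → ℕ) : Set (TruncTensor ℂ d k) :=
  zariskiClosure {x | ∃ X : ℝ → Fin d → ℝ,
    IsGeometricSpline r m X ∧ x = complexify (pathSignature k X)}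

/-- The signature variety `P^r_{d,≤k,m}` of parametric splines. -/
def paramSplineVariety (d k r : ℕ) {ℓ : ℕ} (m : Fin ℓ → ℕ) : Set (TruncTensor ℂ d k) :=
  zariskiClosure {x | ∃ X : ℝ → Fin d → ℝ,
    IsParametricSpline r m X ∧ x = complexify (pathSignature k X)}

end

open Finset Polynomial

noncomputable section

attribute [local instance] LieRing.ofAssociativeRing

/-! ### The filtration of the tensor algebra by order -/

namespace TensorAlg

variable {K : Type*} [Field K] {d : ℕ}

/-! Irreducibility. Two splines with factors `ρ` and `ρ'` are joined by a family depending
polynomially on a parameter `t`: the free coefficients and the factors are interpolated linearly,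
and the coefficients of order at most `r` of each later piece are computed from the preceding piece
(`splineLerp`); `r ≤ m i` leaves room for them. Signatures are formed over any commutative
`ℚ`-algebra, so over `ℝ[X]` they become polynomials in `t` (`map_node`). Any two signatures thus lie
on a polynomial curve meeting the signature set for all real `t` in `[0,1]`. If a product of two
polynomials vanished on the set it would vanish along the curve, hence so would one of the factors
(`IsCurveConnected.eval_mul_ne_zero`): the vanishing ideal is prime.

Upper bound for the varieties. The logarithm is a polynomial map, so the group is Zariski closed
(`exists_separating_polynomial`). The left-invariant fields of the letters are tangent to it, so
they preserve its vanishing ideal (`vectorField_eval_eq_zero`). A signature is reached from the unit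
by flowing along combinations of these fields, and a Taylor expansion shows that the ideal vanishes
there (`eval_node_eq_zero`).

Lower bound. Conversely, a space of polynomials that vanishes at the unit and is stable under the
letter fields is stable under the fields of all Lie elements, hence vanishes along every curve
`exp(s p)` (`eval_eq_zero_of_stable`). The polynomials vanishing on the signatures of all compactly
supported splines form such a space: appending a B-spline in direction `b` multiplies the signature
by `exp(c e_b)`, and one differentiates in `c` (`eval_eq_zero_of_compactSplines`). Their vanishing
ideals for `n` steps form a descending chain of primes, which stabilizes because heights do
(`exists_stable_vanishing`). So some finite `n` suffices, and every `m` with at least `n` entries is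
covered.

If `m` has fewer entries and `M` is large, one entry is large. On that piece alone use velocities
divisible by `X^r (1-X)^r`, and rest on the others. By Weierstrass these approximate compactly
supported continuous velocities, the signature is continuous in the velocity, and stabilization
again bounds the required degree (`exists_weightedVelocities`). -/

/-- The coefficient of a tensor at a word. -/
def cf (p : TensorAlg K d) (w : List (Fin d)) : K := p.coeff (FreeMonoid.ofList w)

@[simp] lemma cf_zero (w : List (Fin d)) : cf (0 : TensorAlg K d) w = 0 := rfl

@[simp] lemma cf_add (p q : TensorAlg K d) (w) : cf (p + q) w = cf p w + cf q w := rfl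

@[simp] lemma cf_sub (p q : TensorAlg K d) (w) : cf (p - q) w = cf p w - cf q w := rfl

@[simp] lemma cf_smul (a : K) (p : TensorAlg K d) (w) : cf (a • p) w = a * cf p w := rfl

@[simp] lemma cf_sum {ι : Type*} (s : Finset ι) (f : ι → TensorAlg K d) (w) :
    cf (∑ i ∈ s, f i) w = ∑ i ∈ s, cf (f i) w := by
  simp [cf, MonoidAlgebra.coeff_sum]

lemma cf_single (u w : List (Fin d)) (a : K) :
    cf (MonoidAlgebra.single (FreeMonoid.ofList u) a) w = if w = u then a else 0 := by
  classical
  rw [cf, MonoidAlgebra.coeff_single]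
  refine Finsupp.single_apply.trans (if_congr ?_ rfl rfl)
  exact FreeMonoid.ofList.injective.eq_iff.trans eq_comm

lemma cf_one (w : List (Fin d)) : cf (1 : TensorAlg K d) w = if w = [] then 1 else 0 := by
  exact cf_single (K := K) [] w 1

lemma cf_letter (i : Fin d) (w : List (Fin d)) :
    cf (letter K i) w = if w = [i] then 1 else 0 := by
  exact cf_single (K := K) [i] w 1

lemma cf_mul (p q : TensorAlg K d) (w : List (Fin d)) :
    cf (p * q) w = ∑ j ∈ range (w.length + 1), cf p (w.take j) * cf q (w.drop j) := by
  classical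
  have hinj : Set.InjOn (fun j => (FreeMonoid.ofList (w.take j), FreeMonoid.ofList (w.drop j)))
      (range (w.length + 1) : Set ℕ) := by
    intro a ha b hb hab
    have h1 : w.take a = w.take b := congrArg Prod.fst hab
    have h2 := congrArg List.length h1
    simp only [coe_range, Set.mem_Iio, List.length_take] at ha hb h2
    omega
  unfold cf
  rw [MonoidAlgebra.coeff_mul_antidiag p q (FreeMonoid.ofList w)
    ((range (w.length + 1)).image
      fun j => (FreeMonoid.ofList (w.take j), FreeMonoid.ofList (w.drop j))), sum_image hinj]
  rintro ⟨a, b⟩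
  simp only [mem_image, mem_range, Prod.mk.injEq]
  constructor
  · rintro ⟨j, -, rfl, rfl⟩
    rw [← FreeMonoid.ofList_append, List.take_append_drop]
  · intro h
    have h' : a.toList ++ b.toList = w := by
      rw [← FreeMonoid.toList_mul, h]; rfl
    refine ⟨a.toList.length, ?_, ?_, ?_⟩
    · rw [← h', List.length_append]; omega
    · rw [← h', List.take_left]; rfl
    · rw [← h', List.drop_left]; rfl

/-- The tensors all of whose words have length at least `n`. -/
def filt (K : Type*) [Field K] (d n : ℕ) : Submodule K (TensorAlg K d) where
  carrier := {p | ∀ w : List (Fin d), w.length < n → cf p w = 0}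
  add_mem' hp hq w hw := by simp [hp w hw, hq w hw]
  zero_mem' w _ := rfl
  smul_mem' a p hp w hw := by simp [hp w hw]

lemma filt_anti {m n : ℕ} (h : m ≤ n) {p : TensorAlg K d} (hp : p ∈ filt K d n) :
    p ∈ filt K d m := fun w hw => hp w (by omega)

lemma mem_filt_zero (p : TensorAlg K d) : p ∈ filt K d 0 := fun w hw => by omega

lemma mul_mem_filt {m n : ℕ} {p q : TensorAlg K d} (hp : p ∈ filt K d m) (hq : q ∈ filt K d n) :
    p * q ∈ filt K d (m + n) := by
  intro w hw
  rw [cf_mul]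
  refine sum_eq_zero fun j hj => ?_
  by_cases h : (w.take j).length < m
  · rw [hp _ h, zero_mul]
  · rw [hq (w.drop j) (by simp at h ⊢; omega), mul_zero]

lemma mul_mem_filt_of_eq {m n l : ℕ} (h : l ≤ m + n) {p q : TensorAlg K d}
    (hp : p ∈ filt K d m) (hq : q ∈ filt K d n) : p * q ∈ filt K d l :=
  filt_anti h (mul_mem_filt hp hq)

lemma pow_mem_filt {p : TensorAlg K d} (hp : p ∈ filt K d 1) (n : ℕ) : p ^ n ∈ filt K d n := by
  induction n with
  | zero => exact mem_filt_zero _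
  | succ n ih => rw [pow_succ]; exact mul_mem_filt ih hp

lemma letter_mem_filt (i : Fin d) : letter K i ∈ filt K d 1 := by
  intro w hw
  rw [cf_letter, if_neg]
  rintro rfl
  simp at hw

lemma freeLie_le_filt {p : TensorAlg K d} (hp : p ∈ freeLie K d) : p ∈ filt K d 1 := by
  unfold freeLie at hp
  induction hp using LieSubalgebra.lieSpan_induction with
  | mem x hx => obtain ⟨i, rfl⟩ := hx; exact letter_mem_filt i
  | zero => exact zero_mem _
  | add x y _ _ hx hy => exact add_mem hx hy
  | smul a x _ hx => exact Submodule.smul_mem _ _ hx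
  | lie x y _ _ hx hy =>
    rw [LieRing.of_associative_ring_bracket]
    exact sub_mem (mul_mem_filt_of_eq (by omega) hx hy) (mul_mem_filt_of_eq (by omega) hy hx)

lemma letter_mem_freeLie (i : Fin d) : letter K i ∈ freeLie K d :=
  LieSubalgebra.subset_lieSpan ⟨i, rfl⟩

lemma trunc_eq_iff {k : ℕ} {p q : TensorAlg K d} :
    trunc k p = trunc k q ↔ p - q ∈ filt K d (k + 1) := by
  constructor
  · intro h w hw
    have := congrFun h ⟨w, by omega⟩
    exact sub_eq_zero.2 this
  · intro h
    ext w
    have h' := h w.1 (by have := w.2; omega)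
    exact sub_eq_zero.1 h'

/-! ### The truncated exponential and its inverse -/

/-- Telescoping: each factor beyond the one carrying `p - q` contributes one more order. -/
lemma pow_sub_pow_mem_filt {p q : TensorAlg K d} (hp : p ∈ filt K d 1) (hq : q ∈ filt K d 1)
    {j : ℕ} (h : p - q ∈ filt K d j) (n : ℕ) : p ^ (n + 1) - q ^ (n + 1) ∈ filt K d (j + n) := by
  induction n with
  | zero => simpa using h
  | succ n ih =>
    have : p ^ (n + 1 + 1) - q ^ (n + 1 + 1) =
        (p ^ (n + 1) - q ^ (n + 1)) * p + q ^ (n + 1) * (p - q) := by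
      rw [pow_succ p (n + 1), pow_succ q (n + 1)]; noncomm_ring
    rw [this]
    exact add_mem (mul_mem_filt_of_eq (by omega) ih hp)
      (mul_mem_filt_of_eq (by omega) (pow_mem_filt hq _) h)

/-- The part of the exponential series of order at least two. -/
def expTail (k : ℕ) (p : TensorAlg K d) : TensorAlg K d :=
  ∑ n ∈ range k, (((n + 1).factorial : K)⁻¹) • p ^ (n + 1) - p

lemma expSum_eq (k : ℕ) (p : TensorAlg K d) : expSum k p = 1 + p + expTail k p := by
  unfold expSum expTail
  rw [sum_range_succ']
  simp
  abel

lemma expTail_sub_mem_filt {k : ℕ} {p q : TensorAlg K d} (hp : p ∈ filt K d 1)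
    (hq : q ∈ filt K d 1) {j : ℕ} (h : p - q ∈ filt K d j) (hj : j ≤ k) :
    expTail k p - expTail k q ∈ filt K d (j + 1) := by
  unfold expTail
  cases k with
  -- For `k = 0` the linear term is missing from the series and `expTail 0 p = -p`; only `j = 0` is
  -- left, where order one of `p` and `q` is enough.
  | zero =>
    obtain rfl : j = 0 := by omega
    rw [range_zero, sum_empty, sum_empty]
    simpa [neg_add_eq_sub] using sub_mem hq hp
  | succ k =>
    rw [sum_range_succ', sum_range_succ']
    have : (∑ n ∈ range k, ((n + 1 + 1).factorial : K)⁻¹ • p ^ (n + 1 + 1)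
          + ((0 + 1).factorial : K)⁻¹ • p ^ (0 + 1) - p)
        - (∑ n ∈ range k, ((n + 1 + 1).factorial : K)⁻¹ • q ^ (n + 1 + 1)
          + ((0 + 1).factorial : K)⁻¹ • q ^ (0 + 1) - q)
        = ∑ n ∈ range k, ((n + 1 + 1).factorial : K)⁻¹ • (p ^ (n + 1 + 1) - q ^ (n + 1 + 1)) := by
      simp [smul_sub]
    rw [this]
    exact sum_mem fun n _ => Submodule.smul_mem _ _
      (filt_anti (by omega) (pow_sub_pow_mem_filt hp hq h (n + 1)))

lemma expSum_sub_mem_filt {k : ℕ} {p q : TensorAlg K d} (hp : p ∈ filt K d 1)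
    (hq : q ∈ filt K d 1) {j : ℕ} (h : p - q ∈ filt K d j) :
    expSum k p - expSum k q ∈ filt K d j := by
  unfold expSum
  rw [← sum_sub_distrib]
  refine sum_mem fun n _ => ?_
  rw [← smul_sub]
  refine Submodule.smul_mem _ _ ?_
  cases n with
  | zero => simp
  | succ n => exact filt_anti (by omega) (pow_sub_pow_mem_filt hp hq h n)

lemma expTail_mem_filt {k : ℕ} {p : TensorAlg K d} (hp : p ∈ filt K d 1) :
    expTail k p ∈ filt K d 1 :=
  sub_mem (sum_mem fun n _ => Submodule.smul_mem _ _
    (filt_anti (by omega) (pow_mem_filt hp (n + 1)))) hp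

/-- Fixed point iteration for the logarithm in the truncated tensor algebra. -/
def logIter (k : ℕ) (x : TensorAlg K d) : ℕ → TensorAlg K d
  | 0 => 0
  | j + 1 => x - 1 - expTail k (logIter k x j)

variable {k : ℕ} {x : TensorAlg K d}

lemma logIter_mem_filt (hx : x - 1 ∈ filt K d 1) (j : ℕ) : logIter k x j ∈ filt K d 1 := by
  induction j with
  | zero => exact zero_mem _
  | succ j ih => exact sub_mem hx (expTail_mem_filt ih)

/-- The iteration is a contraction for the filtration, since `expTail` has no terms of degree below
two and so raises the order of a difference. The logarithm is thereby found in `k` steps, each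
polynomial in `x`. -/
lemma logIter_succ_sub_mem_filt (hx : x - 1 ∈ filt K d 1) (j : ℕ) (hj : j ≤ k) :
    logIter k x (j + 1) - logIter k x j ∈ filt K d (j + 1) := by
  induction j with
  | zero =>
    have : logIter k x (0 + 1) - logIter k x 0 = (x - 1) - expTail k 0 := by simp [logIter]
    rw [this]
    exact sub_mem hx (expTail_mem_filt (zero_mem _))
  | succ j ih =>
    have : logIter k x (j + 1 + 1) - logIter k x (j + 1) =
        -(expTail k (logIter k x (j + 1)) - expTail k (logIter k x j)) := by
      simp only [logIter]; abel
    rw [this]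
    exact neg_mem (expTail_sub_mem_filt (logIter_mem_filt hx _) (logIter_mem_filt hx _)
      (ih (by omega)) (by omega))

lemma expSum_logIter (hx : x - 1 ∈ filt K d 1) :
    expSum k (logIter k x k) - x ∈ filt K d (k + 1) := by
  have : expSum k (logIter k x k) - x = -(logIter k x (k + 1) - logIter k x k) := by
    rw [expSum_eq]; simp only [logIter]; abel
  rw [this]
  exact neg_mem (logIter_succ_sub_mem_filt hx k le_rfl)

/-- Any exponential preimage `p` is a fixed point of the iteration up to order `k + 1`, so the
iterates approach it; this is the uniqueness of the logarithm. -/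
lemma logIter_expSum {p : TensorAlg K d} (hp : p ∈ filt K d 1) (hx : x - 1 ∈ filt K d 1)
    (h : x - expSum k p ∈ filt K d (k + 1)) (j : ℕ) (hj : j ≤ k) :
    logIter k x j - p ∈ filt K d (j + 1) := by
  induction j with
  | zero => simpa [logIter] using neg_mem hp
  | succ j ih =>
    have : logIter k x (j + 1) - p =
        (x - expSum k p) - (expTail k (logIter k x j) - expTail k p) := by
      rw [expSum_eq]; simp only [logIter]; abel
    rw [this]
    exact sub_mem (filt_anti (by omega) h)
      (expTail_sub_mem_filt (logIter_mem_filt hx _) hp (ih (by omega)) (by omega))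

end TensorAlg

instance TruncWord.finite (d k : ℕ) : Finite (TruncWord d k) := List.finite_length_le (Fin d) k

instance TruncWord.fintype (d k : ℕ) : Fintype (TruncWord d k) := Fintype.ofFinite _

/-! ### Polynomial functions -/

/-- Functions on an affine space that are given by a polynomial. -/
def IsPolyFun {K σ : Type*} [Field K] (f : (σ → K) → K) : Prop :=
  ∃ F : MvPolynomial σ K, ∀ x, MvPolynomial.eval x F = f x

namespace IsPolyFun

variable {K σ : Type*} [Field K] {f g : (σ → K) → K}

lemma const (a : K) : IsPolyFun fun _ : σ → K => a := ⟨MvPolynomial.C a, fun x => by simp⟩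

lemma coord (i : σ) : IsPolyFun fun x : σ → K => x i := ⟨MvPolynomial.X i, fun x => by simp⟩

lemma add (hf : IsPolyFun f) (hg : IsPolyFun g) : IsPolyFun fun x => f x + g x := by
  obtain ⟨F, hF⟩ := hf
  obtain ⟨G, hG⟩ := hg
  exact ⟨F + G, fun x => by simp [hF, hG]⟩

lemma mul (hf : IsPolyFun f) (hg : IsPolyFun g) : IsPolyFun fun x => f x * g x := by
  obtain ⟨F, hF⟩ := hf
  obtain ⟨G, hG⟩ := hg
  exact ⟨F * G, fun x => by simp [hF, hG]⟩

lemma sub (hf : IsPolyFun f) (hg : IsPolyFun g) : IsPolyFun fun x => f x - g x := by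
  obtain ⟨F, hF⟩ := hf
  obtain ⟨G, hG⟩ := hg
  exact ⟨F - G, fun x => by simp [hF, hG]⟩

lemma sum {ι : Type*} (s : Finset ι) {f : ι → (σ → K) → K} (hf : ∀ i ∈ s, IsPolyFun (f i)) :
    IsPolyFun fun x => ∑ i ∈ s, f i x := by
  classical
  induction s using Finset.induction_on with
  | empty => simpa using const 0
  | insert a s ha ih =>
    simp only [sum_insert ha]
    exact (hf a (mem_insert_self a s)).add (ih fun i hi => hf i (mem_insert_of_mem hi))

end IsPolyFun

/-! ### The logarithm as a polynomial map and closedness of the group -/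

namespace TensorAlg

variable {K : Type*} [Field K] {d k : ℕ}

/-- A tensor of a given truncation. -/
def lift (x : TruncTensor K d k) : TensorAlg K d :=
  ∑ w : TruncWord d k, MonoidAlgebra.single (FreeMonoid.ofList w.1) (x w)

lemma cf_lift (x : TruncTensor K d k) (w : List (Fin d)) :
    cf (lift x) w = if h : w.length ≤ k then x ⟨w, h⟩ else 0 := by
  classical
  unfold lift
  rw [cf_sum]
  simp only [cf_single]
  split_ifs with h
  · rw [sum_eq_single ⟨w, h⟩]
    · simp
    · rintro ⟨b, hb⟩ - hne
      rw [if_neg]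
      rintro rfl
      exact hne rfl
    · simp
  · refine sum_eq_zero fun b _ => if_neg ?_
    rintro rfl
    exact h b.2

lemma trunc_lift (x : TruncTensor K d k) : trunc k (lift x) = x := by
  ext w
  exact (cf_lift x w.1).trans (dif_pos w.2)

lemma lift_trunc_sub (p : TensorAlg K d) : lift (trunc k p) - p ∈ filt K d (k + 1) :=
  trunc_eq_iff.1 (trunc_lift _)

lemma isPolyFun_cf_lift (w : List (Fin d)) :
    IsPolyFun fun x : TruncTensor K d k => cf (lift x) w := by
  simp only [cf_lift]
  split_ifs with h
  · exact IsPolyFun.coord _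
  · exact IsPolyFun.const 0

lemma isPolyFun_cf_mul {p q : TruncTensor K d k → TensorAlg K d}
    (hp : ∀ w, IsPolyFun fun x => cf (p x) w) (hq : ∀ w, IsPolyFun fun x => cf (q x) w) (w) :
    IsPolyFun fun x => cf (p x * q x) w := by
  simp only [cf_mul]
  exact IsPolyFun.sum _ fun j _ => (hp _).mul (hq _)

lemma isPolyFun_cf_pow {p : TruncTensor K d k → TensorAlg K d}
    (hp : ∀ w, IsPolyFun fun x => cf (p x) w) (n : ℕ) (w) :
    IsPolyFun fun x => cf (p x ^ n) w := by
  induction n generalizing w with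
  | zero => simpa using IsPolyFun.const _
  | succ n ih => simpa only [pow_succ] using isPolyFun_cf_mul ih hp w

lemma isPolyFun_cf_logIter (j : ℕ) (w) :
    IsPolyFun fun x : TruncTensor K d k => cf (logIter k (lift x) j) w := by
  induction j generalizing w with
  | zero => exact IsPolyFun.const _
  | succ j ih =>
    simp only [logIter, expTail, cf_sub, cf_sum, cf_smul]
    refine ((isPolyFun_cf_lift w).sub (IsPolyFun.const _)).sub (IsPolyFun.sub ?_ (ih w))
    exact IsPolyFun.sum _ fun n _ => (IsPolyFun.const _).mul (isPolyFun_cf_pow ih _ w)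

lemma lift_sub_one_mem_filt {x : TruncTensor K d k} (h : x ⟨[], Nat.zero_le k⟩ = 1) :
    lift x - 1 ∈ filt K d 1 := by
  intro w hw
  obtain rfl : w = [] := List.length_eq_zero_iff.1 (by omega)
  have h2 : cf (lift x) [] = 1 := (cf_lift x []).trans ((dif_pos (Nat.zero_le k)).trans h)
  rw [cf_sub, cf_one, h2, if_pos rfl, sub_self]

lemma expSum_sub_one_mem_filt {p : TensorAlg K d} (hp : p ∈ filt K d 1) :
    expSum k p - 1 ∈ filt K d 1 := by
  rw [expSum_eq]
  have : 1 + p + expTail k p - 1 = p + expTail k p := by abel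
  rw [this]
  exact add_mem hp (expTail_mem_filt hp)

/-- The truncation as a linear map. -/
def truncL (K : Type*) [Field K] (d k : ℕ) : TensorAlg K d →ₗ[K] TruncTensor K d k where
  toFun := trunc k
  map_add' _ _ := rfl
  map_smul' _ _ := rfl

/-- The free `k`-step nilpotent Lie algebra inside the truncated tensor space. -/
def truncLie (K : Type*) [Field K] (d k : ℕ) : Submodule K (TruncTensor K d k) :=
  (freeLie K d).toSubmodule.map (truncL K d k)

lemma mem_truncLie {x : TruncTensor K d k} :
    x ∈ truncLie K d k ↔ ∃ p ∈ freeLie K d, trunc k p = x := Iff.rfl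

/-- Existence and uniqueness of the truncated logarithm turn membership in an image into conditions
on `x` itself: a constant term and a linear condition on a polynomial map. -/
lemma mem_freeNilpotentGroup_iff (x : TruncTensor K d k) :
    x ∈ freeNilpotentGroup K d k ↔
      x ⟨[], Nat.zero_le k⟩ = 1 ∧ trunc k (logIter k (lift x) k) ∈ truncLie K d k := by
  rw [mem_truncLie]
  constructor
  · rintro ⟨p, hp, rfl⟩
    have hp1 := freeLie_le_filt hp
    have h1 : trunc k (expSum k p) ⟨[], Nat.zero_le k⟩ = 1 := by
      have := expSum_sub_one_mem_filt (k := k) hp1 [] (by simp)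
      rw [cf_sub, cf_one, if_pos rfl] at this
      exact sub_eq_zero.1 this
    refine ⟨h1, p, hp, ?_⟩
    rw [eq_comm, trunc_eq_iff]
    exact logIter_expSum hp1 (lift_sub_one_mem_filt h1) (lift_trunc_sub _) k le_rfl
  · rintro ⟨h1, p, hp, hpx⟩
    have hx := lift_sub_one_mem_filt h1
    refine ⟨p, hp, ?_⟩
    rw [← trunc_lift x, trunc_eq_iff]
    have h2 := expSum_sub_mem_filt (k := k) (freeLie_le_filt hp) (logIter_mem_filt hx k)
      (trunc_eq_iff.1 hpx)
    have h3 := neg_mem (add_mem h2 (expSum_logIter (k := k) hx))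
    simpa using h3

/-- The free nilpotent group is Zariski closed. -/
theorem exists_separating_polynomial {x : TruncTensor K d k} (hx : x ∉ freeNilpotentGroup K d k) :
    ∃ F : MvPolynomial (TruncWord d k) K,
      (∀ y ∈ freeNilpotentGroup K d k, MvPolynomial.eval y F = 0) ∧
        MvPolynomial.eval x F ≠ 0 := by
  classical
  rw [mem_freeNilpotentGroup_iff, not_and_or] at hx
  rcases hx with hx | hx
  · refine ⟨MvPolynomial.X ⟨[], Nat.zero_le k⟩ - 1, fun y hy => ?_, ?_⟩
    · simp [((mem_freeNilpotentGroup_iff y).1 hy).1]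
    · simpa [sub_eq_zero] using hx
  -- A linear functional separating the logarithm of `x` from the Lie algebra, composed with the
  -- polynomial logarithm, is the separating polynomial.
  · obtain ⟨f, hf, hle⟩ := Submodule.exists_le_ker_of_notMem hx
    have hpoly : IsPolyFun fun y : TruncTensor K d k => f (trunc k (logIter k (lift y) k)) := by
      rw [show (fun y : TruncTensor K d k => f (trunc k (logIter k (lift y) k))) = fun y =>
        ∑ w, trunc k (logIter k (lift y) k) w • f fun j => if w = j then 1 else 0 from
        funext fun y => f.pi_apply_eq_sum_univ _]
      exact IsPolyFun.sum _ fun w _ => (isPolyFun_cf_logIter k w.1).mul (IsPolyFun.const _)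
    obtain ⟨F, hF⟩ := hpoly
    refine ⟨F, fun y hy => ?_, by rwa [hF]⟩
    rw [hF]
    exact hle ((mem_freeNilpotentGroup_iff y).1 hy).2

/-! ### The derivative of the exponential -/

/-- The map `q ↦ q p - p q`. -/
def negAd (p : TensorAlg K d) : TensorAlg K d →ₗ[K] TensorAlg K d :=
  LinearMap.mulRight K p - LinearMap.mulLeft K p

lemma negAd_apply (p q : TensorAlg K d) : negAd p q = q * p - p * q := rfl

lemma negAd_mem_filt {p q : TensorAlg K d} (hp : p ∈ filt K d 1) {n : ℕ} (hq : q ∈ filt K d n)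
    (j : ℕ) : (negAd p ^ j) q ∈ filt K d (n + j) := by
  induction j with
  | zero => exact hq
  | succ j ih =>
    rw [pow_succ', Module.End.mul_apply, negAd_apply]
    exact sub_mem (mul_mem_filt_of_eq (by omega) ih hp) (mul_mem_filt_of_eq (by omega) hp ih)

lemma negAd_mem_freeLie {p q : TensorAlg K d} (hp : p ∈ freeLie K d) (hq : q ∈ freeLie K d)
    (j : ℕ) : (negAd p ^ j) q ∈ freeLie K d := by
  induction j with
  | zero => exact hq
  | succ j ih =>
    rw [pow_succ', Module.End.mul_apply, negAd_apply, ← LieRing.of_associative_ring_bracket]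
    exact LieSubalgebra.lie_mem _ ih hp

/-- The derivative of `s ↦ (p + s q) ^ n` at `s = 0`. -/
def powDeriv (p q : TensorAlg K d) : ℕ → TensorAlg K d
  | 0 => 0
  | n + 1 => p * powDeriv p q n + q * p ^ n

/-- Right multiplication by `p` is the sum of the commuting operators `negAd p` and left
multiplication, so the binomial theorem applies. -/
lemma mul_pow_eq_sum (p q : TensorAlg K d) (n : ℕ) :
    q * p ^ n = ∑ j ∈ range (n + 1), (n.choose j : K) • (p ^ (n - j) * (negAd p ^ j) q) := by
  have h : LinearMap.mulRight K p = negAd p + LinearMap.mulLeft K p := by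
    unfold negAd; abel
  have hc : Commute (negAd p) (LinearMap.mulLeft K p) := by
    refine LinearMap.ext fun y => ?_
    simp only [Module.End.mul_apply, negAd_apply, LinearMap.mulLeft_apply]
    noncomm_ring
  have h2 := congrArg (fun f : Module.End K (TensorAlg K d) => f q)
    (congrArg (fun f : Module.End K (TensorAlg K d) => f ^ n) h)
  simp only [hc.add_pow, LinearMap.pow_mulRight, LinearMap.mulRight_apply] at h2
  rw [h2, LinearMap.sum_apply]
  refine sum_congr rfl fun j _ => ?_
  rw [(hc.pow_pow j (n - j)).eq, ← (Nat.cast_commute (n.choose j) _).eq, Module.End.mul_apply,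
    Module.End.mul_apply, LinearMap.pow_mulLeft, LinearMap.mulLeft_apply, Nat.cast_smul_eq_nsmul]
  exact Module.End.natCast_apply _ _

/-- Induction with Pascal's rule: all powers of `p` are moved to the left, and only iterated
commutators with `q` remain. -/
lemma powDeriv_eq_sum (p q : TensorAlg K d) (n : ℕ) :
    powDeriv p q n =
      ∑ j ∈ range n, (n.choose (j + 1) : K) • (p ^ (n - 1 - j) * (negAd p ^ j) q) := by
  induction n with
  | zero => rfl
  | succ n ih =>
    rw [powDeriv, ih, mul_pow_eq_sum, mul_sum]
    have : ∑ j ∈ range (n + 1), ((n + 1).choose (j + 1) : K) •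
        (p ^ (n + 1 - 1 - j) * (negAd p ^ j) q) =
        ∑ j ∈ range (n + 1), (n.choose (j + 1) : K) • (p ^ (n - j) * (negAd p ^ j) q) +
        ∑ j ∈ range (n + 1), (n.choose j : K) • (p ^ (n - j) * (negAd p ^ j) q) := by
      rw [← sum_add_distrib]
      refine sum_congr rfl fun j _ => ?_
      rw [Nat.choose_succ_succ, Nat.cast_add, add_smul, add_comm, Nat.add_sub_cancel]
    rw [this, sum_range_succ (fun j => (n.choose (j + 1) : K) • _) n, Nat.choose_eq_zero_of_lt (Nat.lt_succ_self n), Nat.cast_zero,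
      zero_smul, add_zero]
    congr 1
    refine sum_congr rfl fun j hj => ?_
    rw [mul_smul_comm, ← mul_assoc, ← pow_succ']
    have := mem_range.1 hj
    congr 4
    omega

variable [CharZero K]

/-- The derivative of the truncated exponential at `p` in the direction `q`. -/
lemma sum_powDeriv_sub_mem_filt {p q : TensorAlg K d} (hp : p ∈ filt K d 1)
    (hq : q ∈ filt K d 1) :
    ∑ n ∈ range (k + 1), ((n.factorial : K)⁻¹) • powDeriv p q n -
      expSum k p * ∑ j ∈ range (k + 1), (((j + 1).factorial : K)⁻¹) • (negAd p ^ j) q ∈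
        filt K d (k + 1) := by
  set f : ℕ → ℕ → TensorAlg K d := fun j m =>
    (((j + 1).factorial : K)⁻¹ * (m.factorial : K)⁻¹) • (p ^ m * (negAd p ^ j) q) with hf
  have hfilt : ∀ j m, f j m ∈ filt K d (m + (1 + j)) := fun j m =>
    Submodule.smul_mem _ _ (mul_mem_filt (pow_mem_filt hp m) (negAd_mem_filt hp hq j))
  -- The degree `n + 1` splits as `(j + 1) + m`, and the binomial coefficient over `(n + 1)!`
  -- becomes `1 / ((j + 1)! m!)`.
  have h1 : ∑ n ∈ range (k + 1), ((n.factorial : K)⁻¹) • powDeriv p q n =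
      ∑ j ∈ range k, ∑ m ∈ range (k - j), f j m := by
    rw [← sum_range_diag_flip, sum_range_succ', powDeriv, smul_zero, add_zero]
    refine sum_congr rfl fun n _ => ?_
    rw [powDeriv_eq_sum, smul_sum]
    refine sum_congr rfl fun j hj => ?_
    have hj' : j + 1 ≤ n + 1 := mem_range.1 hj
    rw [smul_smul, hf]
    simp only [Nat.add_sub_cancel]
    congr 1
    have h := Nat.choose_mul_factorial_mul_factorial hj'
    rw [show n + 1 - (j + 1) = n - j by omega] at h
    have h' : ((n + 1).choose (j + 1) : K) * ((j + 1).factorial : K) * ((n - j).factorial : K) =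
      ((n + 1).factorial : K) := by exact_mod_cast h
    have e1 : ((n + 1).factorial : K) ≠ 0 := Nat.cast_ne_zero.2 (Nat.factorial_ne_zero _)
    have e2 : ((j + 1).factorial : K) ≠ 0 := Nat.cast_ne_zero.2 (Nat.factorial_ne_zero _)
    have e3 : ((n - j).factorial : K) ≠ 0 := Nat.cast_ne_zero.2 (Nat.factorial_ne_zero _)
    rw [mul_assoc] at h'
    rw [eq_div_of_mul_eq (mul_ne_zero e2 e3) h', div_eq_mul_inv, inv_mul_cancel_left₀ e1, mul_inv]
  have h2 : expSum k p * ∑ j ∈ range (k + 1), (((j + 1).factorial : K)⁻¹) • (negAd p ^ j) q =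
      ∑ j ∈ range (k + 1), ∑ m ∈ range (k + 1), f j m := by
    rw [expSum, mul_sum]
    refine sum_congr rfl fun j _ => ?_
    rw [sum_mul]
    refine sum_congr rfl fun m _ => ?_
    rw [smul_mul_smul_comm, mul_comm]
  -- The square of indices exceeds the triangle only by terms with `j + m ≥ k`, which have order at
  -- least `k + 1`.
  have h3 : ∀ j ∈ range k, ∑ m ∈ range (k - j), f j m - ∑ m ∈ range (k + 1), f j m ∈
      filt K d (k + 1) := by
    intro j _
    rw [← neg_sub, ← sum_sdiff (range_mono (show k - j ≤ k + 1 by omega)), add_sub_cancel_right]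
    refine neg_mem (sum_mem fun m hm => filt_anti ?_ (hfilt j m))
    simp only [mem_sdiff, mem_range] at hm
    omega
  rw [h1, h2, sum_range_succ, ← sub_sub, ← sum_sub_distrib]
  exact sub_mem (sum_mem h3) (sum_mem fun m _ => filt_anti (by omega) (hfilt k m))

/-- The derivative of the truncated exponential, at a Lie element, hits every left translate of
a Lie element. -/
theorem exists_expDeriv_eq {p e : TensorAlg K d} (hp : p ∈ freeLie K d) (he : e ∈ freeLie K d) :
    ∃ q ∈ freeLie K d, ∑ n ∈ range (k + 1), ((n.factorial : K)⁻¹) • powDeriv p q n -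
      expSum k p * e ∈ filt K d (k + 1) := by
  have hp1 := freeLie_le_filt hp
  let Ψ : TensorAlg K d → TensorAlg K d := fun q =>
    ∑ j ∈ range k, (((j + 1 + 1).factorial : K)⁻¹) • (negAd p ^ (j + 1)) q
  have hΨsub : ∀ a b, Ψ a - Ψ b = Ψ (a - b) := fun a b => by
    simp only [Ψ, map_sub, smul_sub, sum_sub_distrib]
  have hΨfilt : ∀ n, ∀ a ∈ filt K d n, Ψ a ∈ filt K d (n + 1) := fun n a ha =>
    sum_mem fun j _ => Submodule.smul_mem _ _ (filt_anti (by omega) (negAd_mem_filt hp1 ha (j + 1)))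
  have hΨLie : ∀ a ∈ freeLie K d, Ψ a ∈ freeLie K d := fun a ha =>
    sum_mem fun j _ => (freeLie K d).smul_mem _ (negAd_mem_freeLie hp ha (j + 1))
  -- The derivative of the exponential is `exp(p)` times `id + Ψ`, where `Ψ` raises the order and
  -- preserves Lie elements. Hence `q + Ψ q = e` is solved by iteration, up to order `k + 1` after
  -- `k` steps.
  let s : ℕ → TensorAlg K d := fun m => (fun q => e - Ψ q)^[m] e
  have hs : ∀ m, s (m + 1) = e - Ψ (s m) := fun m => Function.iterate_succ_apply' _ _ _
  have hsLie : ∀ m, s m ∈ freeLie K d := by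
    intro m
    induction m with
    | zero => exact he
    | succ m ih => rw [hs]; exact sub_mem he (hΨLie _ ih)
  have hsd : ∀ m, s (m + 1) - s m ∈ filt K d (m + 1) := by
    intro m
    induction m with
    | zero =>
      rw [hs]
      simpa [s] using hΨfilt 0 e (mem_filt_zero _)
    | succ m ih =>
      have : s (m + 1 + 1) - s (m + 1) = -(Ψ (s (m + 1) - s m)) := by
        rw [hs (m + 1), ← hΨsub]
        nth_rewrite 2 [hs m]
        abel
      rw [this]
      exact neg_mem (hΨfilt _ _ ih)
  refine ⟨s k, hsLie k, ?_⟩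
  have h1 : ∑ j ∈ range (k + 1), (((j + 1).factorial : K)⁻¹) • (negAd p ^ j) (s k) - e ∈
      filt K d (k + 1) := by
    rw [sum_range_succ']
    have : ∑ j ∈ range k, (((j + 1 + 1).factorial : K)⁻¹) • (negAd p ^ (j + 1)) (s k) +
        (((0 + 1).factorial : K)⁻¹) • (negAd p ^ 0) (s k) - e = -(s (k + 1) - s k) := by
      rw [hs]
      simp [Ψ]
      abel
    rw [this]
    exact neg_mem (hsd k)
  have h2 := sum_powDeriv_sub_mem_filt (k := k) hp1 (freeLie_le_filt (hsLie k))
  have h3 := mul_mem_filt_of_eq (m := 0) (n := k + 1) (l := k + 1) (by omega)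
    (mem_filt_zero (expSum k p)) h1
  rw [mul_sub] at h3
  simpa using add_mem h2 h3

end TensorAlg

/-! ### Invariant vector fields on the truncated tensor space -/

section VectorField

open TensorAlg

variable {K : Type*} [Field K] {d k : ℕ}

/-- A prefix of a word of bounded length. -/
def TruncWord.take (w : TruncWord d k) (j : ℕ) : TruncWord d k :=
  ⟨w.1.take j, (List.length_take_le' _ _).trans w.2⟩

/-- The vector field on `T^{≤k}(K^d)` whose value at `x` is the product of `x` and `p`. -/
def vectorField (k : ℕ) (p : TensorAlg K d) :
    Derivation K (MvPolynomial (TruncWord d k) K) (MvPolynomial (TruncWord d k) K) :=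
  MvPolynomial.mkDerivation K fun w => ∑ j ∈ range (w.1.length + 1),
    MvPolynomial.C (cf p (w.1.drop j)) * MvPolynomial.X (w.take j)

lemma vectorField_X (p : TensorAlg K d) (w : TruncWord d k) :
    vectorField k p (MvPolynomial.X w) = ∑ j ∈ range (w.1.length + 1),
      MvPolynomial.C (cf p (w.1.drop j)) * MvPolynomial.X (w.take j) :=
  MvPolynomial.mkDerivation_X _ _ _

lemma vectorField_zero : vectorField k (0 : TensorAlg K d) = 0 :=
  MvPolynomial.derivation_ext fun w => by simp [vectorField_X]

lemma vectorField_add (p q : TensorAlg K d) :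
    vectorField k (p + q) = vectorField k p + vectorField k q :=
  MvPolynomial.derivation_ext fun w => by simp [vectorField_X, add_mul, sum_add_distrib]

lemma vectorField_smul (a : K) (p : TensorAlg K d) :
    vectorField k (a • p) = a • vectorField k p :=
  MvPolynomial.derivation_ext fun w => by
    simp [vectorField_X, smul_sum, MvPolynomial.smul_eq_C_mul, mul_assoc]

lemma vectorField_sub (p q : TensorAlg K d) :
    vectorField k (p - q) = vectorField k p - vectorField k q :=
  MvPolynomial.derivation_ext fun w => by simp [vectorField_X, sub_mul, sum_sub_distrib]

/-- This is associativity of `x * p * q`. It is restricted to coordinates because a composite of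
derivations is not a derivation; only the commutator extends to all polynomials. -/
lemma vectorField_mul_X (p q : TensorAlg K d) (w : TruncWord d k) :
    vectorField k (p * q) (MvPolynomial.X w) =
      vectorField k p (vectorField k q (MvPolynomial.X w)) := by
  rw [vectorField_X, vectorField_X, map_sum]
  simp only [← MvPolynomial.smul_eq_C_mul, Derivation.map_smul, vectorField_X, cf_mul, sum_smul,
    smul_sum, smul_smul]
  have hL : ∀ j ∈ range (w.1.length + 1),
      ∑ i ∈ range ((w.1.drop j).length + 1),
        (cf p ((w.1.drop j).take i) * cf q ((w.1.drop j).drop i)) •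
          (MvPolynomial.X (w.take j) : MvPolynomial (TruncWord d k) K) =
      ∑ i ∈ range (w.1.length + 1 - j), (cf p ((w.1.drop j).take i) * cf q (w.1.drop (j + i))) •
          (MvPolynomial.X (w.take j) : MvPolynomial (TruncWord d k) K) := by
    intro j hj
    have := mem_range.1 hj
    rw [List.length_drop, show w.1.length - j + 1 = w.1.length + 1 - j by omega]
    simp only [List.drop_drop]
  rw [sum_congr rfl hL, ← sum_range_diag_flip _ fun j i =>
    (cf p ((w.1.drop j).take i) * cf q (w.1.drop (j + i))) •
          (MvPolynomial.X (w.take j) : MvPolynomial (TruncWord d k) K)]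
  refine sum_congr rfl fun m hm => ?_
  have hm' := mem_range.1 hm
  have hlen : (w.take m).1.length = m := by
    simp [TruncWord.take]; omega
  rw [hlen]
  refine sum_congr rfl fun j hj => ?_
  have hj' := mem_range.1 hj
  have e1 : (w.take m).take j = w.take j := by
    apply Subtype.ext
    simp only [TruncWord.take, List.take_take]
    congr 1; omega
  have e2 : (w.take m).1.drop j = (w.1.drop j).take (m - j) := by
    simp only [TruncWord.take, List.drop_take]
  rw [e1, e2, show j + (m - j) = m by omega, mul_comm]

lemma vectorField_bracket (p q : TensorAlg K d) :
    vectorField k ⁅p, q⁆ = ⁅vectorField k p, vectorField k q⁆ := by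
  refine MvPolynomial.derivation_ext fun w => ?_
  rw [LieRing.of_associative_ring_bracket, vectorField_sub, Derivation.commutator_apply,
    Derivation.sub_apply, vectorField_mul_X, vectorField_mul_X]

/-- A space of polynomials that is stable under the vector fields of the letters is stable under
the vector fields of all Lie elements. -/
lemma vectorField_mem_of_mem_freeLie (I : Submodule K (MvPolynomial (TruncWord d k) K))
    (hI : ∀ i : Fin d, ∀ F ∈ I, vectorField k (letter K i) F ∈ I) {p : TensorAlg K d}
    (hp : p ∈ freeLie K d) : ∀ F ∈ I, vectorField k p F ∈ I := by
  unfold freeLie at hp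
  induction hp using LieSubalgebra.lieSpan_induction with
  | mem x hx => obtain ⟨i, rfl⟩ := hx; exact hI i
  | zero => intro F _; simp [vectorField_zero]
  | add x y _ _ hx hy =>
    intro F hF
    rw [vectorField_add]
    exact add_mem (hx F hF) (hy F hF)
  | smul a x _ hx =>
    intro F hF
    rw [vectorField_smul]
    exact I.smul_mem a (hx F hF)
  | lie x y _ _ hx hy =>
    intro F hF
    rw [vectorField_bracket, Derivation.commutator_apply]
    exact sub_mem (hx _ (hy F hF)) (hy _ (hx F hF))

/-- The chain rule for polynomial functions along polynomial curves. -/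
lemma derivative_aeval {σ ι : Type*} (s : Finset ι) (γ : σ → K[X]) (v : ι → K[X])
    (D : ι → Derivation K (MvPolynomial σ K) (MvPolynomial σ K))
    (h : ∀ w, derivative (γ w) =
      ∑ i ∈ s, v i * MvPolynomial.aeval γ (D i (MvPolynomial.X w)))
    (F : MvPolynomial σ K) :
    derivative (MvPolynomial.aeval γ F) = ∑ i ∈ s, v i * MvPolynomial.aeval γ (D i F) := by
  induction F using MvPolynomial.induction_on with
  | C a => simp [MvPolynomial.derivation_C]
  | add F G hF hG => simp [hF, hG, mul_add, sum_add_distrib]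
  | mul_X F w hF =>
    rw [map_mul, derivative_mul, hF, MvPolynomial.aeval_X, h w, sum_mul, mul_sum,
      ← sum_add_distrib]
    refine sum_congr rfl fun i _ => ?_
    simp only [Derivation.leibniz, smul_eq_mul, map_add, map_mul, MvPolynomial.aeval_X]
    ring

/-- The unit of the truncated tensor algebra. -/
def unitTensor (K : Type*) [Field K] (d k : ℕ) : TruncTensor K d k :=
  fun w => if w.1 = [] then 1 else 0

lemma eval_aeval_polynomial {σ : Type*} (γ : σ → K[X]) (F : MvPolynomial σ K) (t : K) :
    (MvPolynomial.aeval γ F).eval t = MvPolynomial.eval (fun w => (γ w).eval t) F := by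
  induction F using MvPolynomial.induction_on with
  | C a => simp
  | add F G hF hG => simp [hF, hG]
  | mul_X F w hF => simp [hF]

lemma unitTensor_mem_freeNilpotentGroup : unitTensor K d k ∈ freeNilpotentGroup K d k := by
  refine ⟨0, zero_mem _, ?_⟩
  ext w
  change _ = cf (expSum k 0) w.1
  rw [expSum_eq, expTail]
  simp [cf_one, unitTensor]

variable [CharZero K]

lemma eq_zero_of_eval_iterate_derivative {h : K[X]} (a : K)
    (hh : ∀ n, (derivative^[n] h).eval a = 0) : h = 0 := by
  have : taylor a h = 0 := by
    ext n
    rw [taylor_coeff, coeff_zero]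
    have h2 : (n.factorial • hasseDeriv n) h = derivative^[n] h := by
      rw [← factorial_smul_hasseDeriv]
    have h3 := congrArg (eval a) h2
    rw [hh n, LinearMap.smul_apply, eval_smul, nsmul_eq_mul] at h3
    exact (mul_eq_zero.1 h3).resolve_left (Nat.cast_ne_zero.2 (Nat.factorial_ne_zero n))
  exact taylor_injective a (this.trans (map_zero _).symm)

/-- A space of polynomials that is stable under the vector fields of the letters and vanishes at
the unit vanishes on the free nilpotent group. -/
theorem eval_eq_zero_of_stable (I : Submodule K (MvPolynomial (TruncWord d k) K))
    (hI : ∀ i : Fin d, ∀ F ∈ I, vectorField k (letter K i) F ∈ I)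
    (hunit : ∀ F ∈ I, MvPolynomial.eval (unitTensor K d k) F = 0)
    {x : TruncTensor K d k} (hx : x ∈ freeNilpotentGroup K d k) :
    ∀ F ∈ I, MvPolynomial.eval x F = 0 := by
  obtain ⟨p, hp, rfl⟩ := hx
  have hp1 := freeLie_le_filt hp
  -- The curve `s ↦ exp(s p)`, an integral curve of the field of `p` with coordinates polynomial in
  -- `s`. Derivatives of `F` along it are again values of members of `I`, so the Taylor series at
  -- the unit is zero.
  let γ : TruncWord d k → K[X] := fun w =>
    ∑ n ∈ range (k + 1), C ((n.factorial : K)⁻¹ * cf (p ^ n) w.1) * X ^ n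
  have hγ : ∀ w, derivative (γ w) = ∑ _i ∈ ({()} : Finset Unit), (1 : K[X]) *
      MvPolynomial.aeval γ (vectorField k p (MvPolynomial.X w)) := by
    intro w
    have h0 : cf (p ^ (k + 1)) w.1 = 0 :=
      pow_mem_filt hp1 (k + 1) w.1 (by have := w.2; omega)
    have h1 : derivative (γ w) =
        ∑ n ∈ range (k + 1), C ((n.factorial : K)⁻¹ * cf (p ^ (n + 1)) w.1) * X ^ n := by
      rw [sum_range_succ, h0, mul_zero, C_0, zero_mul, add_zero, derivative_sum,
        sum_range_succ']
      simp only [derivative_C_mul, derivative_X_pow, Nat.factorial_zero, pow_zero, mul_zero,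
        derivative_one, add_zero, Nat.add_sub_cancel]
      refine sum_congr rfl fun n _ => ?_
      rw [← mul_assoc, ← C_mul]
      congr 2
      rw [Nat.factorial_succ, Nat.cast_mul]
      have e1 : ((n + 1 : ℕ) : K) ≠ 0 := Nat.cast_ne_zero.2 (Nat.succ_ne_zero n)
      field_simp
    rw [h1, sum_singleton, one_mul, vectorField_X]
    simp only [map_sum, map_mul, MvPolynomial.aeval_X, pow_succ p, cf_mul]
    simp only [γ, mul_sum, sum_mul]
    rw [sum_comm]
    refine sum_congr rfl fun j _ => sum_congr rfl fun n _ => ?_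
    simp only [TruncWord.take, MvPolynomial.algHom_C, algebraMap_eq, C_mul]
    ring
  have hder : ∀ n, ∀ F ∈ I, ∃ G ∈ I, derivative^[n] (MvPolynomial.aeval γ F) =
      MvPolynomial.aeval γ G := by
    intro n
    induction n with
    | zero => exact fun F hF => ⟨F, hF, rfl⟩
    | succ n ih =>
      intro F hF
      obtain ⟨G, hG, hFG⟩ := ih F hF
      refine ⟨vectorField k p G, vectorField_mem_of_mem_freeLie I hI hp G hG, ?_⟩
      rw [Function.iterate_succ_apply', hFG, derivative_aeval _ γ _ (fun _ => vectorField k p) hγ]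
      simp
  have hγ0 : (fun w => (γ w).eval 0) = unitTensor K d k := by
    ext w
    simp only [γ, eval_finsetSum, eval_mul, eval_C, eval_pow, eval_X]
    rw [sum_range_succ', sum_eq_zero fun n _ => by simp]
    simp [cf_one, unitTensor]
  have hγ1 : (fun w => (γ w).eval 1) = trunc k (expSum k p) := by
    ext w
    simp only [γ, eval_finsetSum, eval_mul, eval_C, eval_pow, eval_X, one_pow, mul_one]
    change _ = cf (expSum k p) w.1
    rw [expSum, cf_sum]
    rfl
  intro F hF
  have hzero : MvPolynomial.aeval γ F = 0 := by
    refine eq_zero_of_eval_iterate_derivative 0 fun n => ?_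
    obtain ⟨G, hG, hFG⟩ := hder n F hF
    rw [hFG, eval_aeval_polynomial, hγ0, hunit G hG]
  rw [← hγ1, ← eval_aeval_polynomial, hzero, eval_zero]

end VectorField

/-! ### Tangency of the letter fields to the group -/

section ComplexVectorField

open TensorAlg

variable {d k : ℕ}

lemma hasDerivAt_cf_pow (p q : TensorAlg ℂ d) (n : ℕ) (w : List (Fin d)) :
    HasDerivAt (fun s : ℂ => cf ((p + s • q) ^ n) w) (cf (powDeriv p q n) w) 0 := by
  induction n generalizing w with
  | zero => simpa [powDeriv] using hasDerivAt_const (0 : ℂ) (cf (1 : TensorAlg ℂ d) w)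
  | succ n ih =>
    simp only [pow_succ', powDeriv, cf_mul, cf_add]
    rw [← sum_add_distrib]
    refine HasDerivAt.fun_sum fun j _ => ?_
    have h1 : HasDerivAt (fun s : ℂ => cf p (w.take j) + cf (s • q) (w.take j))
        (cf q (w.take j)) 0 := by
      simp only [cf_smul]
      simpa using ((hasDerivAt_id (0 : ℂ)).mul_const (cf q (w.take j))).const_add
        (cf p (w.take j))
    have h2 := h1.fun_mul (ih (w.drop j))
    refine h2.congr_deriv ?_
    simp [add_comm]

lemma hasDerivAt_mvPolynomial_eval {σ : Type*} (γ : ℂ → σ → ℂ)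
    (D : Derivation ℂ (MvPolynomial σ ℂ) (MvPolynomial σ ℂ))
    (h : ∀ w, HasDerivAt (fun s => γ s w) (MvPolynomial.eval (γ 0) (D (MvPolynomial.X w))) 0)
    (F : MvPolynomial σ ℂ) :
    HasDerivAt (fun s => MvPolynomial.eval (γ s) F) (MvPolynomial.eval (γ 0) (D F)) 0 := by
  induction F using MvPolynomial.induction_on with
  | C a => simpa [MvPolynomial.derivation_C] using hasDerivAt_const (0 : ℂ) a
  | add F G hF hG => simpa using hF.fun_add hG
  | mul_X F w hF =>
    have := hF.fun_mul (h w)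
    simp only [map_mul, MvPolynomial.eval_X, Derivation.leibniz, smul_eq_mul, map_add]
    refine this.congr_deriv ?_
    ring

/-- The polynomials vanishing on the free nilpotent group are stable under the vector fields of
the letters. -/
theorem vectorField_eval_eq_zero {F : MvPolynomial (TruncWord d k) ℂ}
    (hF : ∀ x ∈ freeNilpotentGroup ℂ d k, MvPolynomial.eval x F = 0) (i : Fin d)
    {x : TruncTensor ℂ d k} (hx : x ∈ freeNilpotentGroup ℂ d k) :
    MvPolynomial.eval x (vectorField k (letter ℂ i) F) = 0 := by
  obtain ⟨p, hp, rfl⟩ := hx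
  obtain ⟨q, hq, hpq⟩ := exists_expDeriv_eq (k := k) hp (letter_mem_freeLie i)
  -- A curve inside the group whose velocity at `s = 0` is `exp(p)` times the letter; `F` is
  -- constantly zero on it.
  let γ : ℂ → TruncTensor ℂ d k := fun s => trunc k (expSum k (p + s • q))
  have hγ0 : γ 0 = trunc k (expSum k p) := by simp [γ]
  have h : ∀ w, HasDerivAt (fun s => γ s w)
      (MvPolynomial.eval (γ 0) (vectorField k (letter ℂ i) (MvPolynomial.X w))) 0 := by
    intro w
    have h1 : HasDerivAt (fun s : ℂ => cf (expSum k (p + s • q)) w.1)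
        (cf (∑ n ∈ range (k + 1), ((n.factorial : ℂ)⁻¹) • powDeriv p q n) w.1) 0 := by
      simp only [expSum, cf_sum, cf_smul]
      exact HasDerivAt.fun_sum fun n _ => (hasDerivAt_cf_pow p q n w.1).const_mul _
    have h2 : cf (∑ n ∈ range (k + 1), ((n.factorial : ℂ)⁻¹) • powDeriv p q n) w.1 =
        cf (expSum k p * letter ℂ i) w.1 :=
      congrFun (trunc_eq_iff.2 hpq) w
    have h3 : MvPolynomial.eval (γ 0) (vectorField k (letter ℂ i) (MvPolynomial.X w)) =
        cf (expSum k p * letter ℂ i) w.1 := by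
      rw [hγ0, vectorField_X, cf_mul, map_sum]
      refine sum_congr rfl fun j _ => ?_
      rw [map_mul, MvPolynomial.eval_C, MvPolynomial.eval_X, mul_comm]
      rfl
    rw [h3, ← h2]
    exact h1
  have h4 := hasDerivAt_mvPolynomial_eval γ _ h F
  have h5 : (fun s => MvPolynomial.eval (γ s) F) = fun _ => 0 := by
    funext s
    exact hF _ ⟨p + s • q, add_mem hp ((freeLie ℂ d).smul_mem s hq), rfl⟩
  rw [h5, hγ0] at h4
  exact h4.unique (hasDerivAt_const _ _)

end ComplexVectorField

/-! ### Formal antiderivatives -/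

namespace Polynomial

variable {R S : Type*} [CommRing R] [Algebra ℚ R] [CommRing S] [Algebra ℚ S]

/-- The antiderivative without constant term. -/
def antideriv (p : R[X]) : R[X] :=
  ∑ n ∈ range (p.natDegree + 1), monomial (n + 1) (algebraMap ℚ R (n + 1)⁻¹ * p.coeff n)

lemma coeff_antideriv_zero (p : R[X]) : (antideriv p).coeff 0 = 0 := by
  simp [antideriv, coeff_monomial]

lemma coeff_antideriv_succ (p : R[X]) (n : ℕ) :
    (antideriv p).coeff (n + 1) = algebraMap ℚ R (n + 1)⁻¹ * p.coeff n := by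
  simp only [antideriv, finsetSum_coeff, coeff_monomial, Nat.add_right_cancel_iff]
  rw [sum_ite_eq']
  split_ifs with h
  · rfl
  · rw [coeff_eq_zero_of_natDegree_lt (by simpa [Nat.lt_succ_iff] using h), mul_zero]

lemma eval_zero_antideriv (p : R[X]) : (antideriv p).eval 0 = 0 := by
  rw [← coeff_zero_eq_eval_zero, coeff_antideriv_zero]

lemma derivative_antideriv (p : R[X]) : derivative (antideriv p) = p := by
  ext n
  rw [coeff_derivative, coeff_antideriv_succ]
  have h : algebraMap ℚ R (n + 1)⁻¹ * (n + 1) = 1 := by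
    rw [show ((n : R) + 1) = algebraMap ℚ R (n + 1) by simp, ← map_mul,
      inv_mul_cancel₀ (by positivity), map_one]
  rw [mul_right_comm, h, one_mul]

lemma natDegree_antideriv_le (p : R[X]) : (antideriv p).natDegree ≤ p.natDegree + 1 :=
  natDegree_sum_le_of_forall_le _ _ fun n hn =>
    (natDegree_monomial_le _).trans (by have := mem_range.1 hn; omega)

lemma antideriv_zero : antideriv (0 : R[X]) = 0 := by
  simp [antideriv]

lemma eq_of_derivative_eq_of_eval_eq {p q : R[X]} (h : derivative p = derivative q)
    (h0 : p.eval 0 = q.eval 0) : p = q := by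
  ext n
  cases n with
  | zero => rwa [coeff_zero_eq_eval_zero, coeff_zero_eq_eval_zero]
  | succ n =>
    have h1 := congrArg (fun f => coeff f n) h
    simp only [coeff_derivative] at h1
    have h : ((n : R) + 1) * algebraMap ℚ R (n + 1)⁻¹ = 1 := by
      rw [show ((n : R) + 1) = algebraMap ℚ R (n + 1) by simp, ← map_mul,
        mul_inv_cancel₀ (by positivity), map_one]
    calc p.coeff (n + 1) = p.coeff (n + 1) * (n + 1) * algebraMap ℚ R (n + 1)⁻¹ := by
          rw [mul_assoc, h, mul_one]
      _ = q.coeff (n + 1) := by rw [h1, mul_assoc, h, mul_one]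

lemma map_antideriv (φ : R →+* S) (p : R[X]) : (antideriv p).map φ = antideriv (p.map φ) := by
  refine eq_of_derivative_eq_of_eval_eq ?_ ?_
  · rw [derivative_map, derivative_antideriv, derivative_antideriv]
  · rw [← coeff_zero_eq_eval_zero, coeff_map, coeff_antideriv_zero, eval_zero_antideriv, map_zero]

end Polynomial

/-! ### Formal signatures of polynomial and piecewise polynomial paths -/

section Flow

variable {R S : Type*} [CommRing R] [Algebra ℚ R] [CommRing S] [Algebra ℚ S] {d : ℕ}

/-- The signature along a polynomial path with velocity `v`, started at `x`. As in `iterInt`,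
words are read from the last letter to the first one. -/
def flow (v : Fin d → R[X]) (x : List (Fin d) → R) : List (Fin d) → R[X]
  | [] => C (x [])
  | a :: u => C (x (a :: u)) + antideriv (flow v x u * v a)

lemma flow_eval_zero (v : Fin d → R[X]) (x : List (Fin d) → R) (L : List (Fin d)) :
    (flow v x L).eval 0 = x L := by
  cases L <;> simp [flow, eval_zero_antideriv]

lemma derivative_flow_cons (v : Fin d → R[X]) (x : List (Fin d) → R) (a : Fin d) (u) :
    derivative (flow v x (a :: u)) = flow v x u * v a := by
  simp [flow, derivative_antideriv]

lemma flow_unique {v : Fin d → R[X]} {x : List (Fin d) → R} {y : List (Fin d) → R[X]}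
    (h0 : ∀ L, (y L).eval 0 = x L) (hnil : derivative (y []) = 0)
    (hcons : ∀ a u, derivative (y (a :: u)) = y u * v a) (L : List (Fin d)) :
    flow v x L = y L := by
  induction L with
  | nil =>
    refine eq_of_derivative_eq_of_eval_eq ?_ (by rw [flow_eval_zero, h0])
    simp [flow, hnil]
  | cons a u ih =>
    refine eq_of_derivative_eq_of_eval_eq ?_ (by rw [flow_eval_zero, h0])
    rw [derivative_flow_cons, hcons, ih]

/-- Reparametrization. -/
lemma flow_comp (v : Fin d → R[X]) (x : List (Fin d) → R) (B : R[X]) (L : List (Fin d)) :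
    flow (fun a => (v a).comp B * derivative B) (fun L => (flow v x L).eval (B.eval 0)) L =
      (flow v x L).comp B := by
  refine flow_unique (y := fun L => (flow v x L).comp B) (fun L => ?_) ?_ (fun a u => ?_) L
  · rw [eval_comp]
  · simp [flow]
  · rw [derivative_comp, derivative_flow_cons, mul_comp]
    ring

lemma map_flow (φ : R →+* S) (v : Fin d → R[X]) (x : List (Fin d) → R) (L : List (Fin d)) :
    (flow v x L).map φ = flow (fun a => (v a).map φ) (fun L => φ (x L)) L := by
  induction L with
  | nil => simp [flow]
  | cons a u ih => simp [flow, map_antideriv, ih]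

lemma flow_zero (x : List (Fin d) → R) (L : List (Fin d)) :
    flow (fun _ => 0) x L = C (x L) := by
  cases L <;> simp [flow, antideriv_zero]

/-- The signature of the constant path. -/
def unitSig (R : Type*) [CommRing R] (d : ℕ) (L : List (Fin d)) : R := if L = [] then 1 else 0

/-- The signature, after `n` steps of length `h`, of a path that has velocity `v i` on the `i`-th
step. -/
def node (v : ℕ → Fin d → R[X]) (h : R) : ℕ → List (Fin d) → R
  | 0 => unitSig R d
  | n + 1 => fun L => (flow (v n) (node v h n) L).eval h

/-- Naturality in the coefficient ring. Evaluation `ℝ[X] → ℝ` shows that signatures of polynomial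
families are polynomial in the parameter; the inclusion `ℝ → ℂ` gives complexification. -/
lemma map_node (φ : R →+* S) (v : ℕ → Fin d → R[X]) (h : R) (n : ℕ) (L : List (Fin d)) :
    φ (node v h n L) = node (fun i a => (v i a).map φ) (φ h) n L := by
  induction n generalizing L with
  | zero => simp only [node, unitSig]; split_ifs <;> simp
  | succ n ih =>
    simp only [node]
    rw [← eval_map_apply, map_flow]
    congr 2
    funext L
    exact ih L

lemma node_congr {v v' : ℕ → Fin d → R[X]} (h : R) {n : ℕ} (hv : ∀ i < n, v i = v' i) :
    node v h n = node v' h n := by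
  induction n with
  | zero => rfl
  | succ n ih =>
    simp only [node]
    rw [ih fun i hi => hv i (by omega), hv n (by omega)]

lemma node_eq_of_zero {v : ℕ → Fin d → R[X]} (h : R) {n m : ℕ} (hnm : n ≤ m)
    (hv : ∀ i, n ≤ i → i < m → v i = 0) : node v h m = node v h n := by
  induction m, hnm using Nat.le_induction with
  | base => rfl
  | succ m hm ih =>
    rw [← ih fun i h1 h2 => hv i h1 (by omega)]
    funext L
    simp only [node]
    rw [hv m hm (by omega)]
    exact (congrArg _ (flow_zero _ L)).trans (by simp)

lemma node_scale (v : ℕ → Fin d → R[X]) {c h : R} (hc : c * h = 1) (n : ℕ) :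
    node (fun i a => (v i a).comp (C c * X) * C c) h n = node v 1 n := by
  induction n with
  | zero => rfl
  | succ n ih =>
    funext L
    simp only [node]
    rw [ih]
    have := flow_comp (v n) (node v 1 n) (C c * X) L
    simp only [derivative_mul, derivative_C, zero_mul, derivative_X, mul_one, zero_add, eval_mul,
      eval_C, eval_X, mul_zero, flow_eval_zero] at this
    rw [this, eval_comp]
    simp [hc]

end Flow

/-! ### Signatures as flows of the letter fields -/

section FlowVectorField

open TensorAlg

variable {K : Type*} [Field K] [CharZero K] {d k : ℕ}

/-- The truncation of a family of coefficients indexed by reversed words. -/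
def toTrunc (k : ℕ) (x : List (Fin d) → K) : TruncTensor K d k := fun w => x w.1.reverse

omit [CharZero K] in
lemma toTrunc_unitSig : toTrunc k (unitSig K d) = unitTensor K d k := by
  ext w
  simp [toTrunc, unitSig, unitTensor]

/-- The signature solves `x' = x * v`: in the coordinate of a nonempty word only the field of the
last letter contributes. -/
lemma derivative_flow_reverse (v : Fin d → K[X]) (x : List (Fin d) → K) (w : TruncWord d k) :
    derivative (flow v x w.1.reverse) = ∑ i, v i *
      MvPolynomial.aeval (fun w : TruncWord d k => flow v x w.1.reverse)
        (vectorField k (letter K i) (MvPolynomial.X w)) := by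
  obtain ⟨w, hw⟩ := w
  simp only [vectorField_X, map_sum, map_mul, MvPolynomial.aeval_X, MvPolynomial.algHom_C,
    TruncWord.take, cf_letter]
  rcases List.eq_nil_or_concat' w with rfl | ⟨u, a, rfl⟩
  · simp [flow]
  · rw [List.reverse_concat, derivative_flow_cons, sum_eq_single a]
    · rw [sum_eq_single u.length]
      · simp [mul_comm]
      · intro j hj hne
        rw [if_neg, map_zero, zero_mul]
        intro h
        have := congrArg List.length h
        simp at this hj
        omega
      · intro h
        simp at h
    · intro i _ hne
      rw [sum_eq_zero, mul_zero]
      intro j _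
      rw [if_neg, map_zero, zero_mul]
      intro h
      have h1 : (u ++ [a]).getLast? = some a := by simp
      have h2 := List.take_append_drop j (u ++ [a])
      rw [h] at h2
      rw [← h2] at h1
      simp at h1
      exact hne h1
    · simp

/-- A space of polynomials that is stable under the vector fields of the letters and vanishes at
`x` vanishes along each path starting at `x`. -/
lemma eval_flow_eq_zero (I : Submodule K (MvPolynomial (TruncWord d k) K))
    (hI : ∀ i : Fin d, ∀ F ∈ I, vectorField k (letter K i) F ∈ I) {x : List (Fin d) → K}
    (hx : ∀ F ∈ I, MvPolynomial.eval (toTrunc k x) F = 0) (v : Fin d → K[X]) (t : K) :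
    ∀ F ∈ I, MvPolynomial.eval (toTrunc k fun L => (flow v x L).eval t) F = 0 := by
  let γ : TruncWord d k → K[X] := fun w => flow v x w.1.reverse
  have hd := derivative_aeval univ γ v (fun i => vectorField k (letter K i))
    (derivative_flow_reverse v x)
  -- The velocities depend on time, so differentiation leaves the `K`-span of the pullbacks; the
  -- `K[X]`-span is stable under it and still vanishes at time zero.
  let N : Submodule K[X] K[X] := Submodule.span K[X] (MvPolynomial.aeval γ '' {F | F ∈ I})
  have hNd : ∀ P ∈ N, derivative P ∈ N := by
    intro P hP
    refine Submodule.span_induction ?_ (by simp) (fun a b _ _ ha hb => ?_) (fun c a hm ha => ?_) hP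
    · rintro _ ⟨F, hF, rfl⟩
      rw [hd]
      exact sum_mem fun i _ => N.smul_mem (v i) (Submodule.subset_span ⟨_, hI i F hF, rfl⟩)
    · rw [derivative_add]
      exact add_mem ha hb
    · rw [smul_eq_mul, derivative_mul]
      exact add_mem (N.smul_mem (derivative c) hm) (N.smul_mem c ha)
  have hN0 : ∀ P ∈ N, P.eval 0 = 0 := by
    intro P hP
    refine Submodule.span_induction ?_ (by simp) (fun a b _ _ ha hb => ?_) (fun c a _ ha => ?_) hP
    · rintro _ ⟨F, hF, rfl⟩
      rw [eval_aeval_polynomial]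
      simp only [γ, flow_eval_zero]
      exact hx F hF
    · rw [eval_add, ha, hb, add_zero]
    · rw [smul_eq_mul, eval_mul, ha, mul_zero]
  intro F hF
  have hzero : MvPolynomial.aeval γ F = 0 := by
    refine eq_zero_of_eval_iterate_derivative 0 fun n => hN0 _ ?_
    induction n with
    | zero => exact Submodule.subset_span ⟨F, hF, rfl⟩
    | succ n ih => rw [Function.iterate_succ_apply']; exact hNd _ ih
  have := eval_aeval_polynomial γ F t
  rw [hzero, eval_zero] at this
  exact this.symm

end FlowVectorField

/-- Polynomials vanishing on the free nilpotent group vanish on signatures. -/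
theorem eval_node_eq_zero {d k : ℕ} {F : MvPolynomial (TruncWord d k) ℂ}
    (hF : ∀ x ∈ freeNilpotentGroup ℂ d k, MvPolynomial.eval x F = 0)
    (v : ℕ → Fin d → ℂ[X]) (h : ℂ) (n : ℕ) :
    MvPolynomial.eval (toTrunc k (node v h n)) F = 0 := by
  let I : Submodule ℂ (MvPolynomial (TruncWord d k) ℂ) :=
    { carrier := {F | ∀ x ∈ freeNilpotentGroup ℂ d k, MvPolynomial.eval x F = 0}
      add_mem' := fun ha hb x hx => by rw [map_add, ha x hx, hb x hx, add_zero]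
      zero_mem' := fun x _ => map_zero _
      smul_mem' := fun c a ha x hx => by rw [MvPolynomial.smul_eval, ha x hx, mul_zero] }
  have hI : ∀ i : Fin d, ∀ F ∈ I, vectorField k (TensorAlg.letter ℂ i) F ∈ I :=
    fun i F hF x hx => vectorField_eval_eq_zero hF i hx
  have key : ∀ n, ∀ F ∈ I, MvPolynomial.eval (toTrunc k (node v h n)) F = 0 := by
    intro n
    induction n with
    | zero =>
      intro F hF
      rw [node, toTrunc_unitSig]
      exact hF _ unitTensor_mem_freeNilpotentGroup
    | succ n ih => exact eval_flow_eq_zero I hI ih (v n) h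
  exact key n F hF

/-! ### Signatures of piecewise polynomial paths -/

section PiecewisePolynomial

open MeasureTheory

variable {d : ℕ}

lemma node_nil {R : Type*} [CommRing R] [Algebra ℚ R] (v : ℕ → Fin d → R[X]) (h : R) (n : ℕ) :
    node v h n [] = 1 := by
  induction n with
  | zero => simp [node, unitSig]
  | succ n ih => simp [node, flow, ih]

lemma hasDerivAt_eval_sub (p : ℝ[X]) (c t : ℝ) :
    HasDerivAt (fun s => p.eval (s - c)) ((derivative p).eval (t - c)) t :=
  (p.hasDerivAt (t - c)).comp_sub_const t c

lemma continuous_eval_sub (p : ℝ[X]) (c : ℝ) : Continuous fun s => p.eval (s - c) :=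
  p.continuous.comp (continuous_id.sub continuous_const)

lemma deriv_of_eq_on_Icc {f : ℝ → ℝ} {p : ℝ[X]} {a b c : ℝ}
    (h : ∀ t ∈ Set.Icc a b, f t = p.eval (t - c)) {t : ℝ} (ht : t ∈ Set.Ioo a b) :
    deriv f t = (derivative p).eval (t - c) := by
  have : f =ᶠ[nhds t] fun s => p.eval (s - c) := by
    filter_upwards [Ioo_mem_nhds ht.1 ht.2] with s hs
    exact h s ⟨hs.1.le, hs.2.le⟩
  rw [this.deriv_eq, (hasDerivAt_eval_sub p c t).deriv]

/-- The pieces of a path, as velocities. -/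
def velocity (P : ℕ → Fin d → ℝ[X]) : ℕ → Fin d → ℝ[X] := fun i a => derivative (P i a)

/-- Induction on the word, with an inner induction over the pieces. On each piece the integrand
agrees with a polynomial away from the control points, where `X` need not be differentiable, and the
fundamental theorem of calculus applies. -/
theorem iterInt_eq_flow {ℓ : ℕ} {P : ℕ → Fin d → ℝ[X]} {X : ℝ → Fin d → ℝ}
    (hX : IsPiecewisePolynomial (fun i : Fin ℓ => P i) X) (L : List (Fin d)) :
    ∀ n < ℓ, ∀ t ∈ Set.Icc ((n : ℝ) / ℓ) (((n : ℝ) + 1) / ℓ),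
      iterInt X L t = (flow (velocity P n) (node (velocity P) (1 / (ℓ : ℝ)) n) L).eval
        (t - n / ℓ) := by
  induction L with
  | nil =>
    intro n _ t _
    simp [iterInt, flow, node_nil]
  | cons a u ih =>
    set v := velocity P with hv
    set g : ℝ → ℝ := fun s => iterInt X u s * deriv (fun τ => X τ a) s with hg
    have piece : ∀ n < ℓ, ∀ t ∈ Set.Icc ((n : ℝ) / ℓ) (((n : ℝ) + 1) / ℓ),
        IntervalIntegrable g volume (n / ℓ) t ∧ ∫ s in ((n : ℝ) / ℓ)..t, g s =
          (flow (v n) (node v (1 / (ℓ : ℝ)) n) (a :: u)).eval (t - n / ℓ) -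
            node v (1 / (ℓ : ℝ)) n (a :: u) := by
      intro n hn t ht
      set Q := flow (v n) (node v (1 / (ℓ : ℝ)) n) (a :: u) with hQ
      have hEq : Set.EqOn (fun s : ℝ => (derivative Q).eval (s - n / ℓ)) g
          (Set.Ioo ((n : ℝ) / ℓ) t) := by
        intro s hs
        have hs' : s ∈ Set.Ioo ((n : ℝ) / ℓ) (((n : ℝ) + 1) / ℓ) := ⟨hs.1, hs.2.trans_le ht.2⟩
        simp only [hg]
        rw [ih n hn s ⟨hs'.1.le, hs'.2.le⟩,
          deriv_of_eq_on_Icc (fun t ht => hX ⟨n, hn⟩ t ht a) hs', hQ, derivative_flow_cons,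
          eval_mul]
        rfl
      have hint : IntervalIntegrable (fun s : ℝ => (derivative Q).eval (s - n / ℓ)) volume
          ((n : ℝ) / ℓ) t := (continuous_eval_sub _ _).intervalIntegrable _ _
      refine ⟨hint.congr_uIoo (by rwa [Set.uIoo_of_le ht.1]), ?_⟩
      rw [← intervalIntegral.integral_congr_Ioo_of_le ht.1 hEq,
        intervalIntegral.integral_eq_sub_of_hasDerivAt (fun s _ => hasDerivAt_eval_sub Q _ s) hint,
        sub_self, hQ, flow_eval_zero]
    have start : ∀ n ≤ ℓ, IntervalIntegrable g volume 0 (n / ℓ) ∧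
        ∫ s in (0 : ℝ)..(n / ℓ), g s = node v (1 / (ℓ : ℝ)) n (a :: u) := by
      intro n
      induction n with
      | zero => intro _; simp [node, unitSig]
      | succ n ihn =>
        intro hn
        have hle : (n : ℝ) / ℓ ≤ ((n : ℝ) + 1) / ℓ := by gcongr; linarith
        obtain ⟨h1, h2⟩ := ihn (by omega)
        obtain ⟨h3, h4⟩ := piece n hn _ ⟨hle, le_rfl⟩
        rw [Nat.cast_succ]
        refine ⟨h1.trans h3, ?_⟩
        rw [← intervalIntegral.integral_add_adjacent_intervals h1 h3, h2, h4]
        simp only [node]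
        rw [show ((n : ℝ) + 1) / ℓ - n / ℓ = 1 / ℓ by ring]
        ring
    intro n hn t ht
    obtain ⟨h1, h2⟩ := start n hn.le
    obtain ⟨h3, h4⟩ := piece n hn t ht
    change ∫ s in (0 : ℝ)..t, g s = _
    rw [← intervalIntegral.integral_add_adjacent_intervals h1 h3, h2, h4]
    ring

theorem pathSignature_eq_node {ℓ : ℕ} (hℓ : 0 < ℓ) {P : ℕ → Fin d → ℝ[X]}
    {X : ℝ → Fin d → ℝ} (hX : IsPiecewisePolynomial (fun i : Fin ℓ => P i) X) (k : ℕ) :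
    pathSignature k X = toTrunc k (node (velocity P) (1 / (ℓ : ℝ)) ℓ) := by
  obtain ⟨n, rfl⟩ : ∃ n, ℓ = n + 1 := ⟨ℓ - 1, by omega⟩
  have hpos : (0 : ℝ) < (n + 1 : ℕ) := by positivity
  have hn1 : ((n : ℝ) + 1) / (n + 1 : ℕ) = 1 := by
    rw [← Nat.cast_succ]; exact div_self hpos.ne'
  ext w
  rw [pathSignature, iterInt_eq_flow hX _ n (Nat.lt_succ_self n) 1 ?_]
  · simp only [toTrunc, node]
    congr 1
    rw [eq_div_iff hpos.ne', sub_mul, div_mul_cancel₀ _ hpos.ne']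
    push_cast
    ring
  · rw [hn1]
    refine ⟨?_, le_rfl⟩
    rw [div_le_one hpos]
    push_cast
    linarith

/-- Polynomial pieces whose values match at the control points can be glued. -/
theorem exists_isPiecewisePolynomial {ℓ : ℕ} (hℓ : 0 < ℓ) (P : ℕ → Fin d → ℝ[X])
    (hP : ∀ n, n + 1 < ℓ → ∀ a, (P n a).eval (1 / (ℓ : ℝ)) = (P (n + 1) a).eval 0) :
    ∃ X : ℝ → Fin d → ℝ, IsPiecewisePolynomial (fun i : Fin ℓ => P i) X := by
  have hpos : (0 : ℝ) < ℓ := by exact_mod_cast hℓ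
  -- The minimum assigns the end point `t = 1` to the last piece.
  let f : ℝ → ℕ := fun t => min ⌊t * ℓ⌋₊ (ℓ - 1)
  refine ⟨fun t a => (P (f t) a).eval (t - f t / ℓ), ?_⟩
  rintro ⟨n, hn⟩ t ⟨h1, h2⟩ a
  simp only at h1 h2 ⊢
  rw [div_le_iff₀ hpos] at h1
  rw [le_div_iff₀ hpos] at h2
  rcases h2.lt_or_eq with h2 | h2
  · have : ⌊t * ℓ⌋₊ = n := by
      rw [Nat.floor_eq_iff ((Nat.cast_nonneg n).trans h1)]
      exact ⟨h1, h2⟩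
    rw [show f t = n by simp only [f, this]; omega]
  · have h3 : ⌊t * ℓ⌋₊ = n + 1 := by
      rw [h2, ← Nat.cast_succ, Nat.floor_natCast]
    have ht : t = ((n : ℝ) + 1) / ℓ := by rw [eq_div_iff hpos.ne', h2]
    by_cases hn1 : n + 1 < ℓ
    · rw [show f t = n + 1 by simp only [f, h3]; omega, ht, Nat.cast_succ, sub_self, ← hP n hn1 a]
      congr 1
      ring
    · rw [show f t = n by simp only [f, h3]; omega]

lemma exists_piece {ℓ : ℕ} (hℓ : 0 < ℓ) {t : ℝ} (ht : t ∈ Set.Icc (0 : ℝ) 1) :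
    ∃ n : Fin ℓ, t ∈ Set.Icc ((n : ℝ) / ℓ) (((n : ℝ) + 1) / ℓ) := by
  have hpos : (0 : ℝ) < ℓ := by exact_mod_cast hℓ
  rcases ht.2.lt_or_eq with h | rfl
  · refine ⟨⟨⌊t * ℓ⌋₊, ?_⟩, ?_, ?_⟩
    · rw [Nat.floor_lt (mul_nonneg ht.1 hpos.le)]
      nlinarith
    · rw [div_le_iff₀ hpos]
      exact Nat.floor_le (mul_nonneg ht.1 hpos.le)
    · rw [le_div_iff₀ hpos]
      exact (Nat.lt_floor_add_one _).le
  · refine ⟨⟨ℓ - 1, by omega⟩, ?_, ?_⟩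
    · rw [div_le_one hpos]
      exact_mod_cast Nat.sub_le ℓ 1
    · rw [le_div_iff₀ hpos]
      simp [Nat.cast_sub (show 1 ≤ ℓ from hℓ)]

lemma IsPiecewisePolynomial.continuousOn {ℓ : ℕ} (hℓ : 0 < ℓ) {p : Fin ℓ → Fin d → ℝ[X]}
    {X : ℝ → Fin d → ℝ} (hX : IsPiecewisePolynomial p X) (a : Fin d) :
    ContinuousOn (fun t => X t a) (Set.Icc 0 1) := by
  have h := (locallyFinite_of_finite fun n : Fin ℓ =>
      Set.Icc ((n : ℝ) / ℓ) (((n : ℝ) + 1) / ℓ)).continuousOn_iUnion (g := fun t => X t a)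
    (fun _ => isClosed_Icc) fun n =>
      ((continuous_eval_sub (p n a) _).continuousOn).congr fun t ht => hX n t ht a
  exact h.mono fun t ht => Set.mem_iUnion.2 (exists_piece hℓ ht)

lemma ae_deriv_eq {ℓ : ℕ} (hℓ : 0 < ℓ) {P : ℕ → Fin d → ℝ[X]} {X U : ℝ → Fin d → ℝ}
    (hX : IsPiecewisePolynomial (fun i : Fin ℓ => P i) X)
    (hU : IsPiecewisePolynomial (fun i : Fin ℓ => velocity P i) U) (a : Fin d) :
    ∀ᵐ s : ℝ, s ∈ Set.Icc (0 : ℝ) 1 → deriv (fun τ => X τ a) s = U s a := by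
  have hc : (Set.range fun n : ℕ => (n : ℝ) / ℓ).Countable := Set.countable_range _
  filter_upwards [hc.ae_notMem volume] with s hs hs01
  obtain ⟨n, hn1, hn2⟩ := exists_piece hℓ hs01
  rw [hU n s ⟨hn1, hn2⟩ a]
  refine deriv_of_eq_on_Icc (fun t ht => hX n t ht a) ⟨lt_of_le_of_ne hn1 ?_, lt_of_le_of_ne hn2 ?_⟩
  · exact fun h => hs ⟨n, h⟩
  · exact fun h => hs ⟨n + 1, by simp [h]⟩

end PiecewisePolynomial

/-! ### Signatures of paths with continuous velocity -/

section ContinuousVelocity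

open MeasureTheory unitInterval

variable {d : ℕ}

/-- The primitive of a continuous function on the unit interval. -/
def primitive (f : C(I, ℝ)) : C(I, ℝ) where
  toFun t := ∫ s in (0 : ℝ)..t, Set.IccExtend zero_le_one f s
  continuous_toFun := (intervalIntegral.continuous_primitive
    (fun a b => (f.continuous.Icc_extend').intervalIntegrable a b) 0).comp continuous_subtype_val

/-- Integration over an interval of length at most one is 1-Lipschitz for the sup norm. -/
lemma continuous_primitive : Continuous primitive := by
  refine LipschitzWith.continuous (K := 1) (LipschitzWith.of_dist_le_mul fun f g => ?_)
  rw [NNReal.coe_one, one_mul, ContinuousMap.dist_le dist_nonneg]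
  intro t
  rw [Real.dist_eq]
  change |(∫ s in (0 : ℝ)..t, Set.IccExtend zero_le_one f s) -
    ∫ s in (0 : ℝ)..t, Set.IccExtend zero_le_one g s| ≤ dist f g
  rw [← intervalIntegral.integral_sub ((f.continuous.Icc_extend').intervalIntegrable _ _)
    ((g.continuous.Icc_extend').intervalIntegrable _ _)]
  have h : ∀ s ∈ Set.uIoc (0 : ℝ) t,
      ‖Set.IccExtend zero_le_one f s - Set.IccExtend zero_le_one g s‖ ≤ dist f g :=
    fun s _ => ContinuousMap.dist_apply_le_dist (f := f) (g := g) (Set.projIcc 0 1 zero_le_one s)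
  refine (intervalIntegral.norm_integral_le_of_norm_le_const h).trans ?_
  rw [sub_zero, abs_of_nonneg t.2.1]
  exact mul_le_of_le_one_right dist_nonneg t.2.2

/-- The signature of the path with velocity `u`; words are read from the last letter to the first
one. -/
def cflow (u : Fin d → C(I, ℝ)) : List (Fin d) → C(I, ℝ)
  | [] => 1
  | a :: w => primitive (cflow u w * u a)

lemma continuous_cflow (L : List (Fin d)) : Continuous fun u : Fin d → C(I, ℝ) => cflow u L := by
  induction L with
  | nil => exact continuous_const
  | cons a w ih => exact continuous_primitive.comp (ih.mul (continuous_apply a))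

lemma iterInt_eq_cflow {X : ℝ → Fin d → ℝ} {u : Fin d → C(I, ℝ)}
    (h : ∀ a, ∀ᵐ s : ℝ, ∀ hs : s ∈ Set.Icc (0 : ℝ) 1, deriv (fun τ => X τ a) s = u a ⟨s, hs⟩)
    (L : List (Fin d)) (t : I) : iterInt X L t = cflow u L t := by
  induction L generalizing t with
  | nil => rfl
  | cons a w ih =>
    change ∫ s in (0 : ℝ)..t, iterInt X w s * deriv (fun τ => X τ a) s =
      ∫ s in (0 : ℝ)..t, Set.IccExtend zero_le_one (cflow u w * u a) s
    refine intervalIntegral.integral_congr_ae ?_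
    filter_upwards [h a] with s hs hst
    rw [Set.uIoc_of_le t.2.1] at hst
    have hs01 : s ∈ Set.Icc (0 : ℝ) 1 := ⟨hst.1.le, hst.2.trans t.2.2⟩
    rw [hs hs01, Set.IccExtend_of_mem _ _ hs01, ContinuousMap.mul_apply, ← ih ⟨s, hs01⟩]

end ContinuousVelocity

/-! ### Zariski closures and irreducibility -/

section Zariski

variable {σ : Type*}

lemma isClosed_zariski_iff {V : Set (σ → ℂ)} : @IsClosed _ (zariskiTopology σ) V ↔
    ∃ F : Set (MvPolynomial σ ℂ), V = {x | ∀ f ∈ F, MvPolynomial.eval x f = 0} := by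
  rw [← @isOpen_compl_iff _ _ (zariskiTopology σ)]
  change Vᶜᶜ ∈ _ ↔ _
  rw [compl_compl]
  rfl

lemma mem_zariskiClosure {S : Set (σ → ℂ)} {x : σ → ℂ} :
    x ∈ zariskiClosure S ↔ ∀ F : MvPolynomial σ ℂ,
      (∀ y ∈ S, MvPolynomial.eval y F = 0) → MvPolynomial.eval x F = 0 := by
  let _ := zariskiTopology σ
  constructor
  · intro hx F hF
    have hc : IsClosed {x | MvPolynomial.eval x F = 0} :=
      isClosed_zariski_iff.2 ⟨{F}, by simp⟩
    exact closure_minimal (s := S) (fun y hy => hF y hy) hc hx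
  · intro h
    refine Set.mem_sInter.2 fun V hV => ?_
    obtain ⟨F, hF⟩ := isClosed_zariski_iff.1 hV.1
    rw [hF]
    intro f hf
    refine h f fun y hy => ?_
    have : y ∈ V := hV.2 hy
    rw [hF] at this
    exact this f hf

/-- Any two points of `S` lie on a polynomial curve that meets `S` infinitely often. -/
def IsCurveConnected (S : Set (σ → ℂ)) : Prop :=
  ∀ x ∈ S, ∀ y ∈ S, ∃ γ : σ → ℂ[X], (fun w => (γ w).eval 0) = x ∧ (fun w => (γ w).eval 1) = y ∧
    {t : ℂ | (fun w => (γ w).eval t) ∈ S}.Infinite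

/-- Primality of the vanishing ideal: pulled back to the curve, a product vanishing on `S` has
infinitely many roots, and `ℂ[X]` is a domain. -/
lemma IsCurveConnected.eval_mul_ne_zero {S : Set (σ → ℂ)} (hS : IsCurveConnected S)
    {F G : MvPolynomial σ ℂ} {x y : σ → ℂ} (hx : x ∈ S) (hy : y ∈ S)
    (hF : MvPolynomial.eval x F ≠ 0) (hG : MvPolynomial.eval y G ≠ 0) :
    ∃ z ∈ S, MvPolynomial.eval z (F * G) ≠ 0 := by
  by_contra! hcon
  obtain ⟨γ, h0, h1, hinf⟩ := hS x hx y hy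
  have hzero : MvPolynomial.aeval γ (F * G) = 0 := by
    refine eq_zero_of_infinite_isRoot _ (hinf.mono fun t ht => ?_)
    rw [Set.mem_ofPred_eq, IsRoot, eval_aeval_polynomial]
    exact hcon _ ht
  rw [map_mul, mul_eq_zero] at hzero
  rcases hzero with h | h
  · apply hF
    rw [← h0, ← eval_aeval_polynomial, h, eval_zero]
  · apply hG
    rw [← h1, ← eval_aeval_polynomial, h, eval_zero]

lemma IsCurveConnected.isZariskiIrreducible {S : Set (σ → ℂ)} (hS : IsCurveConnected S)
    (hne : S.Nonempty) : IsZariskiIrreducible (zariskiClosure S) := by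
  let _ := zariskiTopology σ
  refine isIrreducible_iff_closure.2 ⟨hne, ?_⟩
  rintro u v hu hv ⟨x, hxS, hxu⟩ ⟨y, hyS, hyv⟩
  have key : ∀ {u : Set (σ → ℂ)}, IsOpen u → ∀ {x}, x ∈ u → ∃ F : MvPolynomial σ ℂ,
      MvPolynomial.eval x F ≠ 0 ∧ ∀ z, MvPolynomial.eval z F ≠ 0 → z ∈ u := by
    intro u hu x hx
    obtain ⟨F, hF⟩ := isClosed_zariski_iff.1 (isClosed_compl_iff.2 hu)
    have hx' : x ∉ uᶜ := fun h => h hx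
    rw [hF] at hx'
    simp only [Set.mem_ofPred_eq, not_forall] at hx'
    obtain ⟨f, hf, hfx⟩ := hx'
    refine ⟨f, hfx, fun z hz => ?_⟩
    by_contra hzu
    have : z ∈ uᶜ := hzu
    rw [hF] at this
    exact hz (this f hf)
  obtain ⟨F, hFx, hF⟩ := key hu hxu
  obtain ⟨G, hGy, hG⟩ := key hv hyv
  obtain ⟨z, hz, hFG⟩ := hS.eval_mul_ne_zero hxS hyS hFx hGy
  rw [map_mul] at hFG
  exact ⟨z, hz, hF z (left_ne_zero_of_mul hFG), hG z (right_ne_zero_of_mul hFG)⟩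

/-- An increasing sequence of curve connected sets has eventually constant Zariski closure. -/
theorem exists_stable_vanishing [Finite σ] {S : ℕ → Set (σ → ℂ)} (hmono : Monotone S)
    (hS : ∀ n, IsCurveConnected (S n)) (hne : (S 0).Nonempty) :
    ∃ n, ∀ F : MvPolynomial σ ℂ, (∀ x ∈ S n, MvPolynomial.eval x F = 0) →
      ∀ m, ∀ x ∈ S m, MvPolynomial.eval x F = 0 := by
  let J : ℕ → Ideal (MvPolynomial σ ℂ) := fun n =>
    { carrier := {F | ∀ x ∈ S n, MvPolynomial.eval x F = 0}
      add_mem' := fun ha hb x hx => by rw [map_add, ha x hx, hb x hx, add_zero]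
      zero_mem' := fun x _ => map_zero _
      smul_mem' := fun c a ha x hx => by rw [smul_eq_mul, map_mul, ha x hx, mul_zero] }
  have hanti : Antitone J := fun a b hab F hF x hx => hF x (hmono hab hx)
  have hprime : ∀ n, (J n).IsPrime := by
    intro n
    refine ⟨?_, ?_⟩
    · rw [Ideal.ne_top_iff_one]
      intro h
      obtain ⟨x, hx⟩ := hne
      have := h x (hmono (Nat.zero_le n) hx)
      simp at this
    · intro F G hFG
      by_contra! hcon
      obtain ⟨h1, h2⟩ := hcon
      have h1' : ¬ ∀ x ∈ S n, MvPolynomial.eval x F = 0 := h1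
      have h2' : ¬ ∀ x ∈ S n, MvPolynomial.eval x G = 0 := h2
      push Not at h1' h2'
      obtain ⟨x, hx, hFx⟩ := h1'
      obtain ⟨y, hy, hGy⟩ := h2'
      obtain ⟨z, hz, hne⟩ := (hS n).eval_mul_ne_zero hx hy hFx hGy
      exact hne (hFG z hz)
  -- The chain of ideals descends, so the noetherian condition does not stop it directly. A strict
  -- inclusion of primes strictly lowers the height, so the chain is constant from an index of
  -- minimal height on.
  let H : ℕ → ℕ∞ := fun n => (J n).height
  obtain ⟨n, hn⟩ : ∃ n, ∀ m, H n ≤ H m := by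
    obtain ⟨y, ⟨n, rfl⟩, hmin⟩ := WellFounded.has_min (wellFounded_lt (α := ℕ∞)) (Set.range H)
      ⟨_, ⟨0, rfl⟩⟩
    exact ⟨n, fun m => not_lt.1 (hmin _ ⟨m, rfl⟩)⟩
  refine ⟨n, fun F hF m x hx => ?_⟩
  have hle : J (max n m) ≤ J n := hanti (le_max_left _ _)
  have heq : J (max n m) = J n := by
    by_contra hneq
    have := hprime (max n m)
    have := Ideal.height_strict_mono_of_isPrime (lt_of_le_of_ne hle hneq)
    exact absurd (hn (max n m)) (not_le.2 this)
  have hFm : F ∈ J (max n m) := by rw [heq]; exact hF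
  exact hFm x (hmono (le_max_right _ _) hx)

end Zariski

/-! ### Curves of signatures -/

section SignatureSet

variable {d k : ℕ}

/-- The signatures of the paths with velocities in `𝒱`, with `n` steps of length `h`. -/
def sigSet (k : ℕ) (𝒱 : Set (ℕ → Fin d → ℝ[X])) (h : ℝ) (n : ℕ) : Set (TruncTensor ℂ d k) :=
  {x | ∃ v ∈ 𝒱, x = complexify (toTrunc k (node v h n))}

lemma complexify_node (v : ℕ → Fin d → ℝ[X]) (h : ℝ) (n : ℕ) :
    complexify (toTrunc k (node v h n)) =
      toTrunc k (node (fun i a => (v i a).map Complex.ofRealHom) (h : ℂ) n) := by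
  ext w
  exact map_node Complex.ofRealHom v h n w.1.reverse

lemma isCurveConnected_sigSet {𝒱 : Set (ℕ → Fin d → ℝ[X])} {h : ℝ} {n : ℕ}
    (hV : ∀ v₀ ∈ 𝒱, ∀ v₁ ∈ 𝒱, ∃ V : ℕ → Fin d → ℝ[X][X],
      (∀ i < n, (fun a => (V i a).map (evalRingHom 0)) = v₀ i) ∧
      (∀ i < n, (fun a => (V i a).map (evalRingHom 1)) = v₁ i) ∧
      ∀ t ∈ Set.Icc (0 : ℝ) 1, (fun i a => (V i a).map (evalRingHom t)) ∈ 𝒱) :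
    IsCurveConnected (sigSet k 𝒱 h n) := by
  rintro x ⟨v₀, hv₀, rfl⟩ y ⟨v₁, hv₁, rfl⟩
  obtain ⟨V, h0, h1, ht⟩ := hV v₀ hv₀ v₁ hv₁
  -- In `ℝ[X][X]` the outer variable is time and the inner one is the parameter of the family;
  -- integrating out time leaves a polynomial in the parameter.
  let γ : TruncWord d k → ℂ[X] := fun w => (node V (C h) n w.1.reverse).map Complex.ofRealHom
  have hγ : ∀ t : ℝ, (fun w => (γ w).eval (t : ℂ)) =
      complexify (toTrunc k (node (fun i a => (V i a).map (evalRingHom t)) h n)) := by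
    intro t
    funext w
    have e1 := map_node (evalRingHom t) V (C h) n w.1.reverse
    rw [coe_evalRingHom, eval_C] at e1
    have e2 : (γ w).eval (t : ℂ) = ((node V (C h) n w.1.reverse).eval t : ℝ) :=
      eval_map_apply (f := Complex.ofRealHom) t
    rw [e2, e1]
    rfl
  refine ⟨γ, ?_, ?_, ?_⟩
  · rw [← node_congr h h0]
    simpa using hγ 0
  · rw [← node_congr h h1]
    simpa using hγ 1
  · refine Set.Infinite.mono ?_ ((Set.Icc_infinite zero_lt_one).image
      (Complex.ofReal_injective.injOn (s := Set.Icc (0 : ℝ) 1)))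
    rintro _ ⟨t, ht01, rfl⟩
    rw [Set.mem_ofPred_eq, hγ t]
    exact ⟨_, ht t ht01, rfl⟩

/-- Linear interpolation of polynomials. -/
def lerp (p q : ℝ[X]) : ℝ[X][X] := C (1 - X) * p.map C + C X * q.map C

lemma map_lerp (p q : ℝ[X]) (t : ℝ) :
    (lerp p q).map (evalRingHom t) = C (1 - t) * p + C t * q := by
  have h : (evalRingHom t).comp (C : ℝ →+* ℝ[X]) = RingHom.id ℝ := by ext; simp
  simp [lerp, Polynomial.map_map, h]

lemma isCurveConnected_sigSet_submodule (𝒱 : Submodule ℝ (ℕ → Fin d → ℝ[X])) (h : ℝ) (n : ℕ) :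
    IsCurveConnected (sigSet k (𝒱 : Set (ℕ → Fin d → ℝ[X])) h n) := by
  refine isCurveConnected_sigSet fun v₀ h₀ v₁ h₁ => ⟨fun i a => lerp (v₀ i a) (v₁ i a), ?_, ?_, ?_⟩
  · intro i _
    funext a
    simp [map_lerp]
  · intro i _
    funext a
    simp [map_lerp]
  · intro t _
    have : (fun i a => (lerp (v₀ i a) (v₁ i a)).map (evalRingHom t)) =
        (1 - t) • v₀ + t • v₁ := by
      funext i a
      simp only [map_lerp, Pi.add_apply, Pi.smul_apply, smul_eq_C_mul]
    rw [this]
    exact 𝒱.add_mem (𝒱.smul_mem _ h₀) (𝒱.smul_mem _ h₁)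

end SignatureSet

/-! ### Spaces of splines -/

section SplineSpace

variable {d k ℓ : ℕ}

/-- The pieces `P i` fit together at the control points with the factors `ρ i s`. -/
def IsSplineData (r : ℕ) (m : Fin ℓ → ℕ) (ρ : ℕ → ℕ → ℝ) (P : ℕ → Fin d → ℝ[X]) : Prop :=
  (∀ (i : Fin ℓ) a, (P i a).natDegree ≤ m i) ∧
    ∀ n, n + 1 < ℓ → ∀ s ≤ r, ∀ a,
      ρ n s * (derivative^[s] (P n a)).eval (1 / (ℓ : ℝ)) = (derivative^[s] (P (n + 1) a)).eval 0

/-- The admissible factors of parametric splines. -/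
def paramFactors : Set (ℕ → ℕ → ℝ) := {fun _ _ => 1}

/-- The admissible factors of geometric splines. -/
def geomFactors : Set (ℕ → ℕ → ℝ) := {ρ | (∀ n s, 0 < ρ n s) ∧ ∀ n, ρ n 0 = 1}

/-- The velocities of splines with factors in `𝓡`. -/
def splineVelocities (d r : ℕ) (m : Fin ℓ → ℕ) (𝓡 : Set (ℕ → ℕ → ℝ)) :
    Set (ℕ → Fin d → ℝ[X]) :=
  {v | ∃ ρ ∈ 𝓡, ∃ P, IsSplineData r m ρ P ∧ v = velocity P}

lemma paramFactors_subset_geomFactors : paramFactors ⊆ geomFactors := by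
  rintro _ rfl
  exact ⟨fun _ _ => one_pos, fun _ => rfl⟩

lemma sigSet_mono {𝒱 𝒲 : Set (ℕ → Fin d → ℝ[X])} (h : 𝒱 ⊆ 𝒲) (t : ℝ) (n : ℕ) :
    sigSet k 𝒱 t n ⊆ sigSet k 𝒲 t n := by
  rintro x ⟨v, hv, rfl⟩
  exact ⟨v, h hv, rfl⟩

/-- Extend a finite sequence of pieces by zero. -/
def extendPieces (p : Fin ℓ → Fin d → ℝ[X]) (n : ℕ) : Fin d → ℝ[X] :=
  if h : n < ℓ then p ⟨n, h⟩ else 0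

lemma extendPieces_coe (p : Fin ℓ → Fin d → ℝ[X]) (i : Fin ℓ) : extendPieces p i = p i := by
  simp [extendPieces]

/-- The matching condition of order zero, with factor one, is continuity: both pieces compute the
value of `X` at the common control point. -/
lemma exists_splineData {r : ℕ} {m : Fin ℓ → ℕ} (hℓ : 0 < ℓ) {𝓡 : Set (ℕ → ℕ → ℝ)}
    {X : ℝ → Fin d → ℝ} {p : Fin ℓ → Fin d → ℝ[X]} (hX : IsPiecewisePolynomial p X)
    (hdeg : ∀ i j, (p i j).natDegree ≤ m i) {ρ : ℕ → ℕ → ℝ} (hρ : ρ ∈ 𝓡) (hρ0 : ∀ n, ρ n 0 = 1)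
    (hfit : ∀ n (hn : n + 1 < ℓ) s, 1 ≤ s → s ≤ r → ∀ a,
      ρ n s * (derivative^[s] (p ⟨n, by omega⟩ a)).eval (1 / (ℓ : ℝ)) =
        (derivative^[s] (p ⟨n + 1, hn⟩ a)).eval 0) :
    complexify (pathSignature k X) ∈ sigSet k (splineVelocities d r m 𝓡) (1 / (ℓ : ℝ)) ℓ := by
  have hpos : (0 : ℝ) < ℓ := by exact_mod_cast hℓ
  refine ⟨velocity (extendPieces p), ⟨ρ, hρ, extendPieces p, ⟨?_, ?_⟩, rfl⟩, ?_⟩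
  · intro i a
    rw [extendPieces_coe]
    exact hdeg i a
  · intro n hn s hs a
    have h1 := extendPieces_coe p ⟨n, by omega⟩
    have h2 := extendPieces_coe p ⟨n + 1, hn⟩
    simp only at h1 h2
    rw [h1, h2]
    rcases Nat.eq_zero_or_pos s with rfl | hs0
    · rw [hρ0, one_mul, Function.iterate_zero, id, id]
      have hle : (n : ℝ) / ℓ ≤ ((n : ℝ) + 1) / ℓ := by gcongr; linarith
      have e1 := hX ⟨n, by omega⟩ (((n : ℝ) + 1) / ℓ) ⟨hle, le_rfl⟩ a
      have e2 := hX ⟨n + 1, hn⟩ (((n : ℝ) + 1) / ℓ) ⟨by simp, by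
        simp only [Nat.cast_add, Nat.cast_one]; gcongr; linarith⟩ a
      rw [e1] at e2
      convert e2 using 2
      · ring
      · simp
    · exact hfit n hn s hs0 hs a
  · rw [pathSignature_eq_node hℓ (P := extendPieces p)]
    simpa only [extendPieces_coe] using hX

lemma exists_path_of_splineData {r : ℕ} {m : Fin ℓ → ℕ} (hℓ : 0 < ℓ) {ρ : ℕ → ℕ → ℝ}
    (hρ0 : ∀ n, ρ n 0 = 1) {P : ℕ → Fin d → ℝ[X]} (hP : IsSplineData r m ρ P) :
    ∃ X : ℝ → Fin d → ℝ, IsPiecewisePolynomial (fun i : Fin ℓ => P i) X ∧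
      pathSignature k X = toTrunc k (node (velocity P) (1 / (ℓ : ℝ)) ℓ) := by
  obtain ⟨X, hX⟩ := exists_isPiecewisePolynomial hℓ P fun n hn a => by
    simpa [hρ0] using hP.2 n hn 0 (Nat.zero_le r) a
  exact ⟨X, hX, pathSignature_eq_node hℓ hX k⟩

theorem geomSplineVariety_eq (k r : ℕ) (hℓ : 0 < ℓ) (m : Fin ℓ → ℕ) :
    geomSplineVariety d k r m =
      zariskiClosure (sigSet k (splineVelocities d r m geomFactors) (1 / (ℓ : ℝ)) ℓ) := by
  classical
  unfold geomSplineVariety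
  congr 1
  ext x
  constructor
  · rintro ⟨X, ⟨p, hX, hdeg, hfit⟩, rfl⟩
    have hfit' : ∀ n s, ∃ ρ : ℝ, 0 < ρ ∧ (s = 0 → ρ = 1) ∧ ∀ hn : n + 1 < ℓ, 1 ≤ s → s ≤ r →
        ∀ a, ρ * (derivative^[s] (p ⟨n, by omega⟩ a)).eval (1 / (ℓ : ℝ)) =
          (derivative^[s] (p ⟨n + 1, hn⟩ a)).eval 0 := by
      intro n s
      by_cases h : n + 1 < ℓ ∧ 1 ≤ s ∧ s ≤ r
      · obtain ⟨ρ, h1, h2⟩ := hfit ⟨n, by omega⟩ ⟨n + 1, h.1⟩ rfl s h.2.1 h.2.2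
        exact ⟨ρ, h1, fun h0 => by omega, fun _ _ _ => h2⟩
      -- Where no derivative condition is imposed the default factor one is used; at order zero this
      -- is the required normalization.
      · exact ⟨1, one_pos, fun _ => rfl, fun h1 h2 h3 => absurd ⟨h1, h2, h3⟩ h⟩
    choose ρ h1 h2 h3 using hfit'
    exact exists_splineData hℓ hX hdeg (ρ := ρ) ⟨h1, fun n => h2 n 0 rfl⟩ (fun n => h2 n 0 rfl)
      fun n hn s hs hsr => h3 n s hn hs hsr
  · rintro ⟨v, ⟨ρ, hρ, P, hP, rfl⟩, rfl⟩
    obtain ⟨X, hX, hsig⟩ := exists_path_of_splineData (k := k) hℓ hρ.2 hP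
    refine ⟨X, ⟨_, hX, hP.1, ?_⟩, by rw [hsig]⟩
    rintro i ⟨i', hi'⟩ rfl s _ hs
    exact ⟨ρ i s, hρ.1 _ _, fun a => hP.2 i hi' s hs a⟩

theorem paramSplineVariety_eq (k r : ℕ) (hℓ : 0 < ℓ) (m : Fin ℓ → ℕ) :
    paramSplineVariety d k r m =
      zariskiClosure (sigSet k (splineVelocities d r m paramFactors) (1 / (ℓ : ℝ)) ℓ) := by
  unfold paramSplineVariety
  congr 1
  ext x
  constructor
  · rintro ⟨X, ⟨p, hX, hdeg, hfit⟩, rfl⟩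
    refine exists_splineData hℓ hX hdeg (Set.mem_singleton _) (fun _ => rfl) fun n hn s hs hsr a => ?_
    rw [one_mul]
    exact hfit _ _ rfl s hs hsr a
  · rintro ⟨v, ⟨ρ, rfl, P, hP, rfl⟩, rfl⟩
    obtain ⟨X, hX, hsig⟩ := exists_path_of_splineData (k := k) hℓ (fun _ => rfl) hP
    refine ⟨X, ⟨_, hX, hP.1, ?_⟩, by rw [hsig]⟩
    rintro i ⟨i', hi'⟩ rfl s _ hs a
    simpa using hP.2 i hi' s hs a

/-! ### Interpolation of splines -/

lemma eval_zero_iterate_derivative {R : Type*} [CommRing R] (p : R[X]) (s : ℕ) :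
    (derivative^[s] p).eval 0 = (s.factorial : R) * p.coeff s := by
  rw [← coeff_zero_eq_eval_zero, coeff_iterate_derivative, zero_add, Nat.descFactorial_self,
    nsmul_eq_mul]

/-- Interpolation between splines with pieces `P`, `P'` and factors `ρ`, `ρ'`: the coefficients of
order at most `r` are determined by the previous piece. -/
def splineLerp (r : ℕ) (h : ℝ) (ρ ρ' : ℕ → ℕ → ℝ) (P P' : ℕ → Fin d → ℝ[X]) :
    ℕ → Fin d → ℝ[X][X]
  | 0 => fun a => lerp (P 0 a) (P' 0 a)
  | n + 1 => fun a => lerp (P (n + 1) a) (P' (n + 1) a) + ∑ s ∈ range (r + 1), monomial s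
      (C (s.factorial : ℝ)⁻¹ * (C (ρ n s) * (1 - X) + C (ρ' n s) * X) *
        (derivative^[s] (splineLerp r h ρ ρ' P P' n a)).eval (C h) -
          (lerp (P (n + 1) a) (P' (n + 1) a)).coeff s)

variable {r : ℕ} {m : Fin ℓ → ℕ} {ρ ρ' : ℕ → ℕ → ℝ} {P P' : ℕ → Fin d → ℝ[X]} {h : ℝ}

/-- The interpolated spline at a given parameter. -/
def splineLerpAt (r : ℕ) (h : ℝ) (ρ ρ' : ℕ → ℕ → ℝ) (P P' : ℕ → Fin d → ℝ[X]) (t : ℝ) (n : ℕ)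
    (a : Fin d) : ℝ[X] := (splineLerp r h ρ ρ' P P' n a).map (evalRingHom t)

lemma splineLerpAt_zero (t : ℝ) (a : Fin d) :
    splineLerpAt r h ρ ρ' P P' t 0 a = C (1 - t) * P 0 a + C t * P' 0 a :=
  map_lerp _ _ _

lemma splineLerpAt_succ (t : ℝ) (n : ℕ) (a : Fin d) :
    splineLerpAt r h ρ ρ' P P' t (n + 1) a =
      C (1 - t) * P (n + 1) a + C t * P' (n + 1) a + ∑ s ∈ range (r + 1), monomial s
      ((s.factorial : ℝ)⁻¹ * ((1 - t) * ρ n s + t * ρ' n s) *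
        (derivative^[s] (splineLerpAt r h ρ ρ' P P' t n a)).eval h -
          (C (1 - t) * P (n + 1) a + C t * P' (n + 1) a).coeff s) := by
  rw [splineLerpAt, splineLerp, Polynomial.map_add, map_lerp, Polynomial.map_sum]
  congr 1
  refine sum_congr rfl fun s _ => ?_
  have e1 : evalRingHom t ((derivative^[s] (splineLerp r h ρ ρ' P P' n a)).eval (C h)) =
      (derivative^[s] (splineLerpAt r h ρ ρ' P P' t n a)).eval h := by
    rw [splineLerpAt, Polynomial.iterate_derivative_map, ← eval_map_apply]
    simp
  rw [map_monomial, map_sub, map_mul, e1, ← map_lerp, coeff_map]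
  congr 3
  simp only [map_mul, map_add, map_sub, coe_evalRingHom, eval_C, eval_X, eval_one]
  ring

lemma coeff_splineLerpAt_succ (t : ℝ) (n : ℕ) (a : Fin d) (s : ℕ) :
    (splineLerpAt r h ρ ρ' P P' t (n + 1) a).coeff s = if s ≤ r then
      (s.factorial : ℝ)⁻¹ * ((1 - t) * ρ n s + t * ρ' n s) *
        (derivative^[s] (splineLerpAt r h ρ ρ' P P' t n a)).eval h
      else (C (1 - t) * P (n + 1) a + C t * P' (n + 1) a).coeff s := by
  rw [splineLerpAt_succ, Polynomial.coeff_add, finsetSum_coeff]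
  simp only [coeff_monomial, sum_ite_eq', mem_range, Nat.lt_succ_iff]
  split_ifs with hs
  · ring
  · ring

/-- The matching conditions hold because they define the coefficients of order at most `r`; these
corrections respect the degree bounds since `r ≤ m i`. -/
lemma isSplineData_splineLerpAt (hm : ∀ i, r ≤ m i)
    (hP : ∀ (i : Fin ℓ) a, (P i a).natDegree ≤ m i)
    (hP' : ∀ (i : Fin ℓ) a, (P' i a).natDegree ≤ m i) (t : ℝ) :
    IsSplineData r m (fun n s => (1 - t) * ρ n s + t * ρ' n s)
      (splineLerpAt r (1 / (ℓ : ℝ)) ρ ρ' P P' t) := by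
  refine ⟨?_, ?_⟩
  · rintro ⟨n, hn⟩ a
    have hlin : (C (1 - t) * P n a + C t * P' n a).natDegree ≤ m ⟨n, hn⟩ :=
      natDegree_add_le_of_degree_le ((natDegree_C_mul_le _ _).trans (hP ⟨n, hn⟩ a))
        ((natDegree_C_mul_le _ _).trans (hP' ⟨n, hn⟩ a))
    cases n with
    | zero => simpa only [splineLerpAt_zero] using hlin
    | succ n =>
      simp only
      rw [splineLerpAt_succ]
      refine natDegree_add_le_of_degree_le hlin (natDegree_sum_le_of_forall_le _ _ fun s hs => ?_)
      refine (natDegree_monomial_le _).trans ?_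
      have := mem_range.1 hs
      have := hm ⟨n + 1, hn⟩
      omega
  · intro n _ s hs a
    rw [eval_zero_iterate_derivative, coeff_splineLerpAt_succ, if_pos hs, ← mul_assoc, ← mul_assoc,
      mul_inv_cancel₀ (Nat.cast_ne_zero.2 (Nat.factorial_ne_zero s)), one_mul]

/-- In a spline the low coefficients are forced by the preceding piece, so the recursion changes
nothing when the linear data already form one. Used at `t = 0` and `t = 1`. -/
lemma splineLerpAt_eq {t : ℝ} {σ : ℕ → ℕ → ℝ} {Q : ℕ → Fin d → ℝ[X]} (hQ : IsSplineData r m σ Q)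
    (hσ : ∀ n s, (1 - t) * ρ n s + t * ρ' n s = σ n s)
    (hl : ∀ n a, C (1 - t) * P n a + C t * P' n a = Q n a) (n : ℕ) (hn : n < ℓ) (a : Fin d) :
    splineLerpAt r (1 / (ℓ : ℝ)) ρ ρ' P P' t n a = Q n a := by
  induction n with
  | zero => rw [splineLerpAt_zero, hl]
  | succ n ih =>
    ext s
    rw [coeff_splineLerpAt_succ, hl, hσ, ih (by omega)]
    split_ifs with hs
    · rw [mul_assoc, hQ.2 n hn s hs a, eval_zero_iterate_derivative, inv_mul_cancel_left₀]
      exact Nat.cast_ne_zero.2 (Nat.factorial_ne_zero s)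
    · rfl

lemma isCurveConnected_splines (hm : ∀ i, r ≤ m i) {𝓡 : Set (ℕ → ℕ → ℝ)} (h𝓡 : Convex ℝ 𝓡) :
    IsCurveConnected (sigSet k (splineVelocities d r m 𝓡) (1 / (ℓ : ℝ)) ℓ) := by
  refine isCurveConnected_sigSet ?_
  rintro _ ⟨ρ, hρ, P, hP, rfl⟩ _ ⟨ρ', hρ', P', hP', rfl⟩
  have hmap : ∀ (t : ℝ) (i : ℕ) (a : Fin d),
      (derivative (splineLerp r (1 / (ℓ : ℝ)) ρ ρ' P P' i a)).map (evalRingHom t) =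
        velocity (splineLerpAt r (1 / (ℓ : ℝ)) ρ ρ' P P' t) i a :=
    fun t i a => (derivative_map _ _).symm
  refine ⟨fun i a => derivative (splineLerp r (1 / (ℓ : ℝ)) ρ ρ' P P' i a), ?_, ?_, ?_⟩
  · intro i hi
    funext a
    rw [hmap, velocity, splineLerpAt_eq hP (by simp) (by simp) i hi]
    rfl
  · intro i hi
    funext a
    rw [hmap, velocity, splineLerpAt_eq hP' (by simp) (by simp) i hi]
    rfl
  · intro t ht
    simp only [hmap]
    refine ⟨_, ?_, _, isSplineData_splineLerpAt (ρ := ρ) (ρ' := ρ') hm hP.1 hP'.1 t, rfl⟩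
    exact h𝓡 hρ hρ' (by linarith [ht.2]) ht.1 (by ring)

lemma convex_geomFactors : Convex ℝ geomFactors := by
  rintro ρ ⟨h1, h2⟩ σ ⟨h3, h4⟩ a b ha hb hab
  refine ⟨fun n s => ?_, fun n => by simp [h2, h4, hab]⟩
  simp only [Pi.add_apply, Pi.smul_apply, smul_eq_mul]
  rcases ha.lt_or_eq with ha | rfl
  · have := mul_pos ha (h1 n s)
    have := mul_nonneg hb (h3 n s).le
    linarith
  · obtain rfl : b = 1 := by linarith
    simpa using h3 n s

lemma nonempty_splines {𝓡 : Set (ℕ → ℕ → ℝ)} (h : paramFactors ⊆ 𝓡) (t : ℝ) (n : ℕ) :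
    (sigSet k (splineVelocities d r m 𝓡) t n).Nonempty :=
  ⟨_, velocity 0, ⟨_, h (Set.mem_singleton _), 0, ⟨by simp, by simp⟩, rfl⟩, rfl⟩

theorem isZariskiIrreducible_paramSplineVariety (hℓ : 0 < ℓ) (hm : ∀ i, r ≤ m i) :
    IsZariskiIrreducible (paramSplineVariety d k r m) := by
  rw [paramSplineVariety_eq k r hℓ m]
  exact (isCurveConnected_splines hm (convex_singleton _)).isZariskiIrreducible
    (nonempty_splines subset_rfl _ _)

theorem isZariskiIrreducible_geomSplineVariety (hℓ : 0 < ℓ) (hm : ∀ i, r ≤ m i) :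
    IsZariskiIrreducible (geomSplineVariety d k r m) := by
  rw [geomSplineVariety_eq k r hℓ m]
  exact (isCurveConnected_splines hm convex_geomFactors).isZariskiIrreducible
    (nonempty_splines paramFactors_subset_geomFactors _ _)

end SplineSpace

/-! ### Splines with compactly supported velocity -/

section Bump

/-- The antiderivatives of the pieces of the cardinal B-spline of degree `r`. -/
def bumpPrimitive (r j : ℕ) : ℝ[X] :=
  ∑ l ∈ range (j + 1),
    C ((-1) ^ l * ((r + 1).choose l : ℝ)) * (X + C (((j - l : ℕ) : ℝ))) ^ (r + 1)

lemma bumpPrimitive_zero (r : ℕ) : bumpPrimitive r 0 = X ^ (r + 1) := by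
  simp [bumpPrimitive]

/-- The next piece continues the previous one up to a multiple of `X ^ (r + 1)`, which does not
affect the derivatives of order at most `r` at the control point. -/
lemma bumpPrimitive_succ (r j : ℕ) : bumpPrimitive r (j + 1) =
    (bumpPrimitive r j).comp (X + 1) +
      C ((-1) ^ (j + 1) * ((r + 1).choose (j + 1) : ℝ)) * X ^ (r + 1) := by
  rw [bumpPrimitive, sum_range_succ, bumpPrimitive, Polynomial.sum_comp]
  congr 1
  · refine sum_congr rfl fun l hl => ?_
    have hl' := mem_range.1 hl
    rw [show j + 1 - l = j - l + 1 by omega]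
    simp only [mul_comp, C_comp, pow_comp, add_comp, X_comp, Nat.cast_succ, C_add, C_1]
    ring
  · simp

lemma eval_one_bumpPrimitive (r j : ℕ) :
    (bumpPrimitive r j).eval 1 = (bumpPrimitive r (j + 1)).eval 0 := by
  rw [bumpPrimitive_succ]
  simp [eval_comp]

/-- Once all `r + 2` terms are present, the sum is the finite difference of order `r + 1` of `x ^ (r
+ 1)`, which is the constant `(r + 1)!`. Hence the B-spline has compact support and nonzero
integral. -/
lemma bumpPrimitive_of_lt {r j : ℕ} (h : r < j) :
    bumpPrimitive r j = C ((r + 1).factorial : ℝ) := by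
  refine Polynomial.funext fun x => ?_
  have h1 := congrFun (fwdDiff_iter_eq_factorial (R := ℝ) (n := r + 1)) (x + (j - (r + 1) : ℕ))
  rw [fwdDiff_iter_eq_sum_shift, ← sum_range_reflect] at h1
  rw [eval_C]
  refine Eq.trans ?_ h1
  rw [bumpPrimitive, eval_finsetSum]
  rw [eventually_constant_sum (N := r + 1 + 1) ?_ (show r + 1 + 1 ≤ j + 1 by omega)]
  · refine sum_congr rfl fun l hl => ?_
    have hl' := mem_range.1 hl
    have e1 : r + 1 - (r + 1 + 1 - 1 - l) = l := by omega
    have e2 : (r + 1).choose (r + 1 + 1 - 1 - l) = (r + 1).choose l := by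
      rw [show r + 1 + 1 - 1 - l = r + 1 - l by omega, Nat.choose_symm (by omega)]
    have e3 : ((j - l : ℕ) : ℝ) = (j - (r + 1) : ℕ) + (r + 1 + 1 - 1 - l : ℕ) := by
      rw [← Nat.cast_add]
      congr 1
      omega
    rw [e1, e2]
    simp only [eval_mul, eval_C, eval_pow, eval_add, eval_X, zsmul_eq_mul, nsmul_eq_mul, mul_one, e3]
    push_cast
    ring
  · intro l hl
    simp [Nat.choose_eq_zero_of_lt (show r + 1 < l by omega)]

lemma eval_iterate_derivative_X_pow {s n : ℕ} (h : s < n) (a : ℝ) :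
    (derivative^[s] (C a * X ^ n : ℝ[X])).eval 0 = 0 := by
  rw [eval_zero_iterate_derivative, coeff_C_mul, coeff_X_pow, if_neg (by omega), mul_zero, mul_zero]

lemma iterate_derivative_comp_X_add_one (p : ℝ[X]) (s : ℕ) :
    derivative^[s] (p.comp (X + 1)) = (derivative^[s] p).comp (X + 1) := by
  induction s with
  | zero => rfl
  | succ s ih =>
    rw [Function.iterate_succ_apply', ih, Function.iterate_succ_apply', derivative_comp]
    simp

/-- The pieces of a multiple of the cardinal B-spline of degree `r`. -/
def bump (r j : ℕ) : ℝ[X] := derivative (bumpPrimitive r j)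

lemma bump_of_lt {r j : ℕ} (h : r < j) : bump r j = 0 := by
  rw [bump, bumpPrimitive_of_lt h, derivative_C]

lemma natDegree_bump_le (r j : ℕ) : (bump r j).natDegree ≤ r := by
  refine (natDegree_derivative_le _).trans (Nat.sub_le_of_le_add ?_)
  refine natDegree_sum_le_of_forall_le _ _ fun l _ => (natDegree_C_mul_le _ _).trans ?_
  exact (natDegree_pow_le).trans (by rw [natDegree_X_add_C, mul_one])

lemma eval_zero_bump_zero {r s : ℕ} (h : s < r) : (derivative^[s] (bump r 0)).eval 0 = 0 := by
  rw [bump, ← Function.iterate_succ_apply, bumpPrimitive_zero]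
  simpa using eval_iterate_derivative_X_pow (show s.succ < r + 1 by omega) 1

lemma eval_bump_succ {r s : ℕ} (h : s < r) (j : ℕ) :
    (derivative^[s] (bump r j)).eval 1 = (derivative^[s] (bump r (j + 1))).eval 0 := by
  rw [bump, bump, ← Function.iterate_succ_apply, ← Function.iterate_succ_apply,
    bumpPrimitive_succ, iterate_map_add derivative, eval_add,
    eval_iterate_derivative_X_pow (show s.succ < r + 1 by omega),
    iterate_derivative_comp_X_add_one, eval_comp]
  simp

end Bump

/-! ### Compactly supported splines detect the group -/

section CompactSplines

variable {d k : ℕ}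

/-- The velocities of splines with unit steps that are constant on the first step and from the
`n`-th step on. -/
def compactSplines (d r n : ℕ) : Submodule ℝ (ℕ → Fin d → ℝ[X]) where
  carrier := {v | (∀ i a, (v i a).natDegree ≤ r) ∧ v 0 = 0 ∧ (∀ i, n ≤ i → v i = 0) ∧
    ∀ i a, ∀ s < r, (derivative^[s] (v i a)).eval 1 = (derivative^[s] (v (i + 1) a)).eval 0}
  add_mem' := by
    rintro v w ⟨h1, h2, h3, h4⟩ ⟨h1', h2', h3', h4'⟩
    refine ⟨fun i a => natDegree_add_le_of_degree_le (h1 i a) (h1' i a), by simp [h2, h2'],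
      fun i hi => by simp [h3 i hi, h3' i hi], fun i a s hs => ?_⟩
    simp only [Pi.add_apply, iterate_map_add derivative, eval_add, h4 i a s hs, h4' i a s hs]
  zero_mem' := ⟨by simp, rfl, fun _ _ => rfl, by simp⟩
  smul_mem' := by
    rintro c v ⟨h1, h2, h3, h4⟩
    refine ⟨fun i a => (natDegree_smul_le _ _).trans (h1 i a), by simp [h2],
      fun i hi => by simp [h3 i hi], fun i a s hs => ?_⟩
    simp only [Pi.smul_apply, Polynomial.iterate_derivative_smul, eval_smul, h4 i a s hs]

lemma compactSplines_mono {r m n : ℕ} (h : m ≤ n) : compactSplines d r m ≤ compactSplines d r n :=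
  fun _ hv => ⟨hv.1, hv.2.1, fun i hi => hv.2.2.1 i (h.trans hi), hv.2.2.2⟩

lemma node_compactSplines {r m n : ℕ} (h : m ≤ n) {v : ℕ → Fin d → ℝ[X]}
    (hv : v ∈ compactSplines d r m) : node v 1 n = node v 1 m :=
  node_eq_of_zero 1 h fun i hi _ => hv.2.2.1 i hi

/-- The velocity of the cardinal B-spline in direction `b`, started at step `n`. -/
def bumpVelocity (d r n : ℕ) (b : Fin d) (i : ℕ) : Fin d → ℝ[X] :=
  if n ≤ i then Pi.single b (bump r (i - n)) else 0

lemma bumpVelocity_mem (r n : ℕ) (hn : 0 < n) (b : Fin d) :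
    bumpVelocity d r n b ∈ compactSplines d r (n + r + 1) := by
  refine ⟨fun i a => ?_, ?_, fun i hi => ?_, fun i a s hs => ?_⟩
  · unfold bumpVelocity
    split_ifs with h
    · rcases eq_or_ne a b with rfl | hab
      · simpa using natDegree_bump_le r (i - n)
      · simp [Pi.single_eq_of_ne hab]
    · simp
  · rw [bumpVelocity, if_neg (by omega)]
  · rw [bumpVelocity, if_pos (by omega), bump_of_lt (by omega), Pi.single_zero]
  · unfold bumpVelocity
    rcases eq_or_ne a b with rfl | hab
    · rcases lt_trichotomy (i + 1) n with h | h | h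
      · rw [if_neg (by omega), if_neg (by omega)]
        simp
      · rw [if_neg (by omega), if_pos (by omega), h, Nat.sub_self, Pi.single_eq_same,
          eval_zero_bump_zero hs]
        simp
      · rw [if_pos (by omega), if_pos (by omega), Pi.single_eq_same, Pi.single_eq_same,
          eval_bump_succ hs, Nat.sub_add_comm (by omega)]
    · have : ∀ j, (if n ≤ j then (Pi.single b (bump r (j - n)) : Fin d → ℝ[X]) else 0) a = 0 := by
        intro j
        split_ifs
        · exact Pi.single_eq_of_ne hab _
        · rfl
      rw [this, this]
      simp

/-- The appended bump moves along a line in direction `b`, so by reparametrization only its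
displacement matters; it may be replaced by constant velocity run for that time. -/
lemma node_add_bumpVelocity {r n : ℕ} (b : Fin d) {v : ℕ → Fin d → ℝ[X]}
    (hv : v ∈ compactSplines d r n) (c : ℝ) (j : ℕ) (L : List (Fin d)) :
    node (v + c • bumpVelocity d r n b) 1 (n + j) L =
      (flow (Pi.single b 1) (node v 1 n) L).eval (c * (bumpPrimitive r j).eval 0) := by
  induction j generalizing L with
  | zero =>
    rw [bumpPrimitive_zero, node_congr (v' := v) 1 fun i hi => ?_]
    · simp [flow_eval_zero]
    · have hi' : ¬ n ≤ i := by omega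
      funext a
      simp [bumpVelocity, hi']
  | succ j ih =>
    rw [← add_assoc, node]
    simp only [funext ih]
    have h1 : (v + c • bumpVelocity d r n b) (n + j) = fun a =>
        ((Pi.single b 1 : Fin d → ℝ[X]) a).comp (C c * bumpPrimitive r j) *
          derivative (C c * bumpPrimitive r j) := by
      funext a
      rw [Pi.add_apply, hv.2.2.1 (n + j) (Nat.le_add_right n j), zero_add, Pi.smul_apply,
        Pi.smul_apply, bumpVelocity, if_pos (Nat.le_add_right n j), Nat.add_sub_cancel_left]
      rcases eq_or_ne a b with rfl | hab
      · simp [bump, smul_eq_C_mul]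
      · simp [Pi.single_eq_of_ne hab]
    have h2 := flow_comp (Pi.single b 1) (node v 1 n) (C c * bumpPrimitive r j) L
    rw [eval_mul, eval_C] at h2
    rw [h1, h2, eval_comp, eval_mul, eval_C, eval_one_bumpPrimitive]

/-- Polynomials vanishing on the signatures of all compactly supported splines of a given degree
vanish on the free nilpotent group. -/
theorem eval_eq_zero_of_compactSplines (r : ℕ) {F : MvPolynomial (TruncWord d k) ℂ}
    (hF : ∀ n, ∀ x ∈ sigSet k (compactSplines d r n : Set (ℕ → Fin d → ℝ[X])) 1 n,
      MvPolynomial.eval x F = 0) {x : TruncTensor ℂ d k} (hx : x ∈ freeNilpotentGroup ℂ d k) :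
    MvPolynomial.eval x F = 0 := by
  let I : Submodule ℂ (MvPolynomial (TruncWord d k) ℂ) :=
    { carrier := {F | ∀ n, ∀ x ∈ sigSet k (compactSplines d r n : Set (ℕ → Fin d → ℝ[X])) 1 n,
        MvPolynomial.eval x F = 0}
      add_mem' := fun ha hb n x hx => by rw [map_add, ha n x hx, hb n x hx, add_zero]
      zero_mem' := fun _ x _ => map_zero _
      smul_mem' := fun c a ha n x hx => by rw [MvPolynomial.smul_eval, ha n x hx, mul_zero] }
  refine eval_eq_zero_of_stable I ?_ ?_ hx F hF
  · intro b F hF n x hx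
    obtain ⟨v, hv, rfl⟩ := hx
    rw [← node_compactSplines (Nat.le_succ n) hv]
    replace hv := compactSplines_mono (Nat.le_succ n) hv
    -- Starting the bump at a positive step keeps the first step at rest.
    set N := n.succ with hN
    let y : List (Fin d) → ℂ := fun L => ((node v 1 N L : ℝ) : ℂ)
    let e : Fin d → ℂ[X] := Pi.single b 1
    let γ : TruncWord d k → ℂ[X] := fun w => flow e y w.1.reverse
    -- `F` vanishes along the ray `y * exp(t e_b)` at all `t = c (r + 1)!` with `c` real, hence
    -- identically; its derivative at `t = 0` is the letter field applied to `F` at `y`.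
    have hzero : MvPolynomial.aeval γ F = 0 := by
      have hfac : ((r + 1).factorial : ℝ) ≠ 0 := Nat.cast_ne_zero.2 (Nat.factorial_ne_zero _)
      refine eq_zero_of_infinite_isRoot _ ((Set.infinite_range_of_injective
        (f := fun c : ℝ => ((c * (r + 1).factorial : ℝ) : ℂ)) fun c c' h => ?_).mono ?_)
      · exact mul_right_cancel₀ hfac (Complex.ofReal_injective h)
      · rintro _ ⟨c, rfl⟩
        rw [Set.mem_ofPred_eq, IsRoot, eval_aeval_polynomial]
        have hmem := (compactSplines d r (N + r + 1)).add_mem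
          (compactSplines_mono (by omega) hv)
          ((compactSplines d r (N + r + 1)).smul_mem c (bumpVelocity_mem r N (Nat.succ_pos n) b))
        have h1 := hF (N + r + 1) _ ⟨_, hmem, rfl⟩
        rw [← h1]
        congr 2
        funext w
        have h2 := node_add_bumpVelocity b hv c (r + 1) w.1.reverse
        rw [bumpPrimitive_of_lt (Nat.lt_succ_self r), eval_C, ← add_assoc] at h2
        change _ = ((node (v + c • bumpVelocity d r N b) 1 (N + r + 1) w.1.reverse : ℝ) : ℂ)
        rw [h2]
        have h3 := map_flow Complex.ofRealHom (Pi.single b 1) (node v 1 N) w.1.reverse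
        have h4 : (fun a => ((Pi.single b 1 : Fin d → ℝ[X]) a).map Complex.ofRealHom) = e := by
          funext a
          rcases eq_or_ne a b with rfl | hab
          · simp [e]
          · simp [e, Pi.single_eq_of_ne hab]
        rw [h4] at h3
        have h5 : γ w = (flow (Pi.single b 1) (node v 1 N) w.1.reverse).map Complex.ofRealHom :=
          h3.symm
        rw [h5]
        exact eval_map_apply (f := Complex.ofRealHom) _
    have hd := derivative_aeval univ γ e (fun i => vectorField k (TensorAlg.letter ℂ i))
      (derivative_flow_reverse e y) F
    rw [hzero, derivative_zero, sum_eq_single b (fun i _ hi => by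
      simp [e, Pi.single_eq_of_ne hi]) (by simp)] at hd
    have h0 := eval_aeval_polynomial γ (vectorField k (TensorAlg.letter ℂ b) F) 0
    simp only [e, Pi.single_eq_same, one_mul] at hd
    rw [← hd, eval_zero] at h0
    have h1 : (fun w => (γ w).eval 0) = complexify (toTrunc k (node v 1 N)) := by
      funext w
      exact flow_eval_zero _ _ _
    rw [h1] at h0
    exact h0.symm
  · intro F hF
    refine hF 0 _ ⟨0, zero_mem _, ?_⟩
    rw [node, toTrunc_unitSig]
    funext w
    simp only [complexify, unitTensor]
    split_ifs <;> simp

lemma sigSet_compactSplines_mono (r : ℕ) : Monotone fun n =>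
    sigSet k (compactSplines d r n : Set (ℕ → Fin d → ℝ[X])) 1 n := by
  rintro m n hmn x ⟨v, hv, rfl⟩
  exact ⟨v, compactSplines_mono hmn hv, by rw [node_compactSplines hmn hv]⟩

/-- There is a number of steps that suffices to detect the free nilpotent group. -/
theorem exists_compactSplines (d k r : ℕ) : ∃ n, ∀ F : MvPolynomial (TruncWord d k) ℂ,
    (∀ x ∈ sigSet k (compactSplines d r n : Set (ℕ → Fin d → ℝ[X])) 1 n,
      MvPolynomial.eval x F = 0) →
    ∀ x ∈ freeNilpotentGroup ℂ d k, MvPolynomial.eval x F = 0 := by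
  obtain ⟨n, hn⟩ := exists_stable_vanishing (sigSet_compactSplines_mono (d := d) (k := k) r)
    (fun n => isCurveConnected_sigSet_submodule _ _ _) ⟨_, 0, zero_mem _, rfl⟩
  exact ⟨n, fun F hF x hx => eval_eq_zero_of_compactSplines r (hn F hF) hx⟩

end CompactSplines

/-! ### Splines with prescribed velocity -/

section ScaledPieces

variable {d k ℓ : ℕ}

/-- The pieces of the path with steps of length `1 / ℓ` that traverses the path with unit steps and
velocities `v`. -/
def scaledPieces (ℓ : ℕ) (v : ℕ → Fin d → ℝ[X]) (i : ℕ) (a : Fin d) : ℝ[X] :=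
  (C (∑ j ∈ range i, (antideriv (v j a)).eval 1) + antideriv (v i a)).comp (C (ℓ : ℝ) * X)

lemma iterate_derivative_comp_C_mul_X (p : ℝ[X]) (c : ℝ) (s : ℕ) :
    derivative^[s] (p.comp (C c * X)) = C (c ^ s) * (derivative^[s] p).comp (C c * X) := by
  induction s with
  | zero => simp
  | succ s ih =>
    rw [Function.iterate_succ_apply', ih, Function.iterate_succ_apply', derivative_C_mul,
      derivative_comp, pow_succ, C_mul]
    simp
    ring

lemma velocity_scaledPieces (v : ℕ → Fin d → ℝ[X]) :
    velocity (scaledPieces ℓ v) = fun i a => (v i a).comp (C (ℓ : ℝ) * X) * C (ℓ : ℝ) := by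
  funext i a
  simp [velocity, scaledPieces, derivative_comp, derivative_antideriv, mul_comm]

lemma node_scaledPieces (hℓ : 0 < ℓ) (v : ℕ → Fin d → ℝ[X]) (n : ℕ) :
    node (velocity (scaledPieces ℓ v)) (1 / (ℓ : ℝ)) n = node v 1 n := by
  have hpos : (ℓ : ℝ) ≠ 0 := by exact_mod_cast hℓ.ne'
  rw [velocity_scaledPieces]
  exact node_scale v (mul_one_div_cancel hpos) n

/-- Rescaling time multiplies both sides by `ℓ ^ s`. Integration turns matching of order `s` into
order `s + 1`, and the accumulated displacements provide order zero. -/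
lemma scaledPieces_fit (hℓ : 0 < ℓ) {r : ℕ} {v : ℕ → Fin d → ℝ[X]}
    (hfit : ∀ i a, ∀ s < r,
      (derivative^[s] (v i a)).eval 1 = (derivative^[s] (v (i + 1) a)).eval 0)
    (n s : ℕ) (hs : s ≤ r) (a : Fin d) :
    (derivative^[s] (scaledPieces ℓ v n a)).eval (1 / (ℓ : ℝ)) =
      (derivative^[s] (scaledPieces ℓ v (n + 1) a)).eval 0 := by
  have hpos : (ℓ : ℝ) ≠ 0 := by exact_mod_cast hℓ.ne'
  rw [scaledPieces, scaledPieces, iterate_derivative_comp_C_mul_X, iterate_derivative_comp_C_mul_X]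
  simp only [eval_mul, eval_comp, eval_C, eval_X, mul_one_div_cancel hpos, mul_zero]
  congr 1
  cases s with
  | zero => simp [sum_range_succ, eval_zero_antideriv, eval_finsetSum]
  | succ s =>
    simpa [derivative_antideriv] using hfit n a s hs

lemma isSplineData_scaledPieces (hℓ : 0 < ℓ) {r : ℕ} {m : Fin ℓ → ℕ} {v : ℕ → Fin d → ℝ[X]}
    (hdeg : ∀ (i : Fin ℓ) a, (v i a).natDegree + 1 ≤ m i)
    (hfit : ∀ i a, ∀ s < r,
      (derivative^[s] (v i a)).eval 1 = (derivative^[s] (v (i + 1) a)).eval 0) :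
    IsSplineData r m (fun _ _ => 1) (scaledPieces ℓ v) := by
  refine ⟨fun i a => ?_, fun n _ s hs a => by rw [one_mul, scaledPieces_fit hℓ hfit n s hs a]⟩
  have h1 : (C (ℓ : ℝ) * X).natDegree ≤ 1 := (natDegree_C_mul_le _ _).trans natDegree_X_le
  calc _ ≤ _ := natDegree_comp_le
    _ ≤ (m i) * 1 := by
      refine Nat.mul_le_mul (natDegree_add_le_of_degree_le ?_ ?_) h1
      · rw [natDegree_C]; exact Nat.zero_le _
      · exact (natDegree_antideriv_le _).trans (hdeg i a)
    _ = m i := mul_one _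

lemma complexify_node_mem (hℓ : 0 < ℓ) {r : ℕ} {m : Fin ℓ → ℕ} {v : ℕ → Fin d → ℝ[X]}
    (hdeg : ∀ (i : Fin ℓ) a, (v i a).natDegree + 1 ≤ m i)
    (hfit : ∀ i a, ∀ s < r,
      (derivative^[s] (v i a)).eval 1 = (derivative^[s] (v (i + 1) a)).eval 0) :
    complexify (toTrunc k (node v 1 ℓ)) ∈
      sigSet k (splineVelocities d r m paramFactors) (1 / (ℓ : ℝ)) ℓ :=
  ⟨_, ⟨_, Set.mem_singleton _, _, isSplineData_scaledPieces hℓ hdeg hfit, rfl⟩,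
    by rw [node_scaledPieces hℓ]⟩

end ScaledPieces

/-! ### Polynomial paths of high degree -/

section SinglePiece

open MeasureTheory unitInterval

variable {d k : ℕ}

/-- The weight with zeros of order `r` at the end points of the unit interval. -/
def weight (r : ℕ) : ℝ[X] := X ^ r * (1 - X) ^ r

/-- The polynomial velocities with zeros of order `r` at the end points. -/
def weightedVelocities (d r D : ℕ) : Submodule ℝ (ℕ → Fin d → ℝ[X]) where
  carrier := {v | ∃ q : Fin d → ℝ[X], (∀ a, (q a).natDegree ≤ D) ∧ ∀ a, v 0 a = weight r * q a}
  add_mem' := by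
    rintro v w ⟨q, hq, hv⟩ ⟨q', hq', hw⟩
    exact ⟨q + q', fun a => natDegree_add_le_of_degree_le (hq a) (hq' a), fun a => by
      rw [Pi.add_apply, Pi.add_apply, hv, hw, Pi.add_apply, mul_add]⟩
  zero_mem' := ⟨0, by simp, by simp⟩
  smul_mem' := by
    rintro c v ⟨q, hq, hv⟩
    exact ⟨c • q, fun a => (natDegree_smul_le _ _).trans (hq a), fun a => by
      rw [Pi.smul_apply, Pi.smul_apply, hv, Pi.smul_apply, mul_smul_comm]⟩

lemma weightedVelocities_mono {r D E : ℕ} (h : D ≤ E) :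
    weightedVelocities d r D ≤ weightedVelocities d r E := by
  rintro v ⟨q, hq, hv⟩
  exact ⟨q, fun a => (hq a).trans h, hv⟩

lemma sigSet_weightedVelocities_mono (r : ℕ) : Monotone fun D =>
    sigSet k (weightedVelocities d r D : Set (ℕ → Fin d → ℝ[X])) 1 1 := by
  intro D E h
  exact sigSet_mono (SetLike.coe_subset_coe.2 (weightedVelocities_mono h)) 1 1

/-- The signature of a path with continuous velocity, as a complex tensor. -/
def contSig (k : ℕ) (u : Fin d → C(I, ℝ)) : TruncTensor ℂ d k :=
  complexify (toTrunc k fun L => cflow u L 1)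

lemma continuous_contSig (k : ℕ) : Continuous (contSig k : (Fin d → C(I, ℝ)) → _) := by
  refine continuous_pi fun w => Complex.continuous_ofReal.comp ?_
  exact (continuous_eval_const (1 : I)).comp (continuous_cflow _)

lemma contSig_polynomial (v : Fin d → ℝ[X]) :
    contSig k (fun a => (v a).toContinuousMapOn I) =
      complexify (toTrunc k (node (fun _ => v) 1 1)) := by
  let P : ℕ → Fin d → ℝ[X] := fun _ a => antideriv (v a)
  let X : ℝ → Fin d → ℝ := fun t a => (antideriv (v a)).eval t
  have hX : IsPiecewisePolynomial (fun i : Fin 1 => P i) X := by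
    intro i t _ a
    simp [X, P]
  have h1 := pathSignature_eq_node one_pos hX k
  have hv : velocity P = fun _ => v := by
    funext i a
    exact derivative_antideriv _
  rw [hv, Nat.cast_one, div_one] at h1
  rw [← h1]
  funext w
  have h2 : ∀ a, ∀ᵐ s : ℝ, ∀ hs : s ∈ Set.Icc (0 : ℝ) 1,
      deriv (fun τ => X τ a) s = (v a).toContinuousMapOn I ⟨s, hs⟩ := by
    refine fun a => Filter.Eventually.of_forall fun s hs => ?_
    simp [X, derivative_antideriv]
  exact congrArg _ (iterInt_eq_cflow h2 w.1.reverse 1).symm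

/-- If a polynomial vanishes on the signatures of all polynomial paths whose velocity is divisible
by the weight, then it vanishes on the signatures of all paths with continuous velocity divisible
by the weight. -/
lemma eval_contSig_eq_zero (r : ℕ) {F : MvPolynomial (TruncWord d k) ℂ}
    (hF : ∀ D, ∀ x ∈ sigSet k (weightedVelocities d r D : Set (ℕ → Fin d → ℝ[X])) 1 1,
      MvPolynomial.eval x F = 0) (g : Fin d → C(I, ℝ)) :
    MvPolynomial.eval (contSig k fun a => (weight r).toContinuousMapOn I * g a) F = 0 := by
  have hcont : Continuous fun g : Fin d → C(I, ℝ) =>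
      MvPolynomial.eval (contSig k fun a => (weight r).toContinuousMapOn I * g a) F :=
    (MvPolynomial.continuous_eval F).comp ((continuous_contSig k).comp
      (continuous_pi fun a => continuous_const.mul (continuous_apply a)))
  have hclosed : IsClosed {g : Fin d → C(I, ℝ) |
      MvPolynomial.eval (contSig k fun a => (weight r).toContinuousMapOn I * g a) F = 0} :=
    isClosed_singleton.preimage hcont
  have hdense : Dense (Set.range fun q : ℝ[X] => q.toContinuousMapOn I) := by
    have h := polynomialFunctions_closure_eq_top'
    have h1 : closure ((polynomialFunctions I : Subalgebra ℝ C(I, ℝ)) : Set C(I, ℝ)) =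
        Set.univ := by
      rw [← Subalgebra.topologicalClosure_coe, h]
      rfl
    rw [polynomialFunctions_coe] at h1
    exact dense_iff_closure_eq.2 h1
  have hpi := dense_pi (Set.univ : Set (Fin d)) (fun _ _ => hdense)
  have hsub : Set.pi Set.univ (fun _ : Fin d => Set.range fun q : ℝ[X] => q.toContinuousMapOn I) ⊆
      {g | MvPolynomial.eval (contSig k fun a => (weight r).toContinuousMapOn I * g a) F = 0} := by
    intro g hg
    choose q hq using fun a => hg a (Set.mem_univ a)
    obtain rfl : (fun a => (q a).toContinuousMapOn I) = g := funext hq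
    have h1 : (fun a => (weight r).toContinuousMapOn I * (q a).toContinuousMapOn I) =
        fun a => (weight r * q a).toContinuousMapOn I := by
      funext a
      ext t
      simp
    rw [Set.mem_ofPred_eq, h1, contSig_polynomial]
    exact hF (univ.sup fun a => (q a).natDegree) _ ⟨fun _ a => weight r * q a,
      ⟨q, fun a => le_sup (f := fun a => (q a).natDegree) (mem_univ a), fun _ => rfl⟩, rfl⟩
  exact hclosed.closure_subset_iff.2 hsub (hpi g)

/-- Where `f` is nonzero the weight is at least `δ`, its value at `1 / ℓ`. Dividing by the maximum
of the weight and `δ` therefore gives a continuous quotient. -/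
lemma eq_weight_mul {ℓ r : ℕ} (hℓ : 2 ≤ ℓ) (f : C(I, ℝ))
    (h0 : ∀ t : I, (t : ℝ) ≤ 1 / ℓ → f t = 0) (h1 : ∀ t : I, ((ℓ - 1 : ℕ) : ℝ) / ℓ ≤ t → f t = 0) :
    ∃ g : C(I, ℝ), f = (weight r).toContinuousMapOn I * g := by
  have hpos : (0 : ℝ) < ℓ := by exact_mod_cast (by omega : 0 < ℓ)
  have hlt : (1 : ℝ) / ℓ < 1 := by
    rw [div_lt_one hpos]
    exact_mod_cast (by omega : 1 < ℓ)
  set δ : ℝ := ((1 / (ℓ : ℝ)) * (1 - 1 / ℓ)) ^ r with hδ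
  have hδpos : 0 < δ := pow_pos (mul_pos (by positivity) (by linarith)) r
  have hmax : ∀ t : I, max ((weight r).toContinuousMapOn I t) δ ≠ 0 := fun t =>
    (lt_max_of_lt_right hδpos).ne'
  refine ⟨⟨fun t => f t / max ((weight r).toContinuousMapOn I t) δ,
    f.continuous.div (((weight r).toContinuousMapOn I).continuous.max continuous_const) hmax⟩, ?_⟩
  ext t
  change f t = (weight r).toContinuousMapOn I t * (f t / max ((weight r).toContinuousMapOn I t) δ)
  by_cases hft : f t = 0
  · rw [hft, zero_div, mul_zero]
  · have ht0 : 1 / (ℓ : ℝ) ≤ t := le_of_lt (not_le.1 fun h => hft (h0 t h))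
    have ht1 : (t : ℝ) ≤ ((ℓ - 1 : ℕ) : ℝ) / ℓ := le_of_lt (not_le.1 fun h => hft (h1 t h))
    have ht1' : (t : ℝ) ≤ 1 - 1 / ℓ := by
      rw [Nat.cast_sub (by omega), Nat.cast_one, sub_div, div_self hpos.ne'] at ht1
      exact ht1
    have hw : δ ≤ (weight r).toContinuousMapOn I t := by
      have : (weight r).toContinuousMapOn I t = ((t : ℝ) * (1 - t)) ^ r := by
        simp [weight, mul_pow]
      rw [this, hδ]
      refine pow_le_pow_left₀ (mul_nonneg (by positivity) (by linarith)) ?_ r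
      nlinarith
    rw [max_eq_left hw, mul_div_cancel₀]
    exact (hδpos.trans_le hw).ne'

/-- Polynomials vanishing on the signatures of all polynomial paths whose velocity is divisible by
the weight vanish on the free nilpotent group. -/
theorem eval_eq_zero_of_weightedVelocities (r : ℕ) {F : MvPolynomial (TruncWord d k) ℂ}
    (hF : ∀ D, ∀ x ∈ sigSet k (weightedVelocities d r D : Set (ℕ → Fin d → ℝ[X])) 1 1,
      MvPolynomial.eval x F = 0) {x : TruncTensor ℂ d k} (hx : x ∈ freeNilpotentGroup ℂ d k) :
    MvPolynomial.eval x F = 0 := by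
  -- Degree one already makes the velocity continuous, which is all that approximation needs; the
  -- regularity `r` is carried by the weight.
  refine eval_eq_zero_of_compactSplines 1 (fun n x hx => ?_) hx
  obtain ⟨v, hv, rfl⟩ := hx
  -- With `n + 1 ≤ ℓ` the last step is at rest, like the first one, so the velocity vanishes near
  -- both ends.
  obtain ⟨ℓ, hℓ, hnℓ⟩ : ∃ ℓ, 2 ≤ ℓ ∧ n + 1 ≤ ℓ := ⟨n + 2, by omega, by omega⟩
  have hℓ0 : 0 < ℓ := by omega
  have hpos : (0 : ℝ) < ℓ := by exact_mod_cast hℓ0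
  have hfit := scaledPieces_fit (ℓ := ℓ) hℓ0 hv.2.2.2
  obtain ⟨X, hX⟩ := exists_isPiecewisePolynomial hℓ0 (scaledPieces ℓ v)
    fun n _ a => hfit n 0 (Nat.zero_le _) a
  obtain ⟨U, hU⟩ := exists_isPiecewisePolynomial hℓ0 (velocity (scaledPieces ℓ v))
    fun n _ a => hfit n 1 le_rfl a
  let u : Fin d → C(I, ℝ) := fun a =>
    ⟨fun t => U t a, continuousOn_iff_continuous_domRestrict.1 (hU.continuousOn hℓ0 a)⟩
  have hsig : complexify (toTrunc k (node v 1 n)) = contSig k u := by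
    rw [← node_compactSplines (show n ≤ ℓ by omega) hv, ← node_scaledPieces hℓ0,
      ← pathSignature_eq_node hℓ0 hX]
    funext w
    have h2 : ∀ a, ∀ᵐ s : ℝ, ∀ hs : s ∈ Set.Icc (0 : ℝ) 1,
        deriv (fun τ => X τ a) s = u a ⟨s, hs⟩ := by
      intro a
      filter_upwards [ae_deriv_eq hℓ0 hX hU a] with s hs hs01
      exact hs hs01
    exact congrArg _ (iterInt_eq_cflow h2 w.1.reverse 1)
  have hU0 : ∀ i : Fin ℓ, v i = 0 → ∀ t ∈ Set.Icc ((i : ℝ) / ℓ) (((i : ℝ) + 1) / ℓ), ∀ a,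
      U t a = 0 := by
    intro i hi t ht a
    rw [hU i t ht a, velocity_scaledPieces]
    simp [hi]
  have hg : ∀ a, ∃ g : C(I, ℝ), u a = (weight r).toContinuousMapOn I * g := by
    refine fun a => eq_weight_mul hℓ (u a) (fun t ht => ?_) fun t ht => ?_
    · exact hU0 ⟨0, hℓ0⟩ hv.2.1 t ⟨by simpa using t.2.1, by simpa using ht⟩ a
    · refine hU0 ⟨ℓ - 1, by omega⟩ (hv.2.2.1 _ (by simp; omega)) t ⟨ht, ?_⟩ a
      have : (((ℓ - 1 : ℕ) : ℝ) + 1) / ℓ = 1 := by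
        rw [div_eq_one_iff_eq hpos.ne']
        exact_mod_cast Nat.succ_pred_eq_of_pos hℓ0
      exact t.2.2.trans this.ge
  choose g hg using hg
  rw [hsig, funext hg]
  exact eval_contSig_eq_zero r hF g

/-- There is a degree that suffices to detect the free nilpotent group. -/
theorem exists_weightedVelocities (d k r : ℕ) : ∃ D, ∀ F : MvPolynomial (TruncWord d k) ℂ,
    (∀ x ∈ sigSet k (weightedVelocities d r D : Set (ℕ → Fin d → ℝ[X])) 1 1,
      MvPolynomial.eval x F = 0) →
    ∀ x ∈ freeNilpotentGroup ℂ d k, MvPolynomial.eval x F = 0 := by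
  obtain ⟨D, hD⟩ := exists_stable_vanishing (sigSet_weightedVelocities_mono (d := d) (k := k) r)
    (fun n => isCurveConnected_sigSet_submodule _ _ _) ⟨_, 0, zero_mem _, rfl⟩
  exact ⟨D, fun F hF x hx => eval_eq_zero_of_weightedVelocities r (hD F hF) hx⟩

end SinglePiece

/-! ### Splines of large total degree -/

section LargeDegree

variable {d k ℓ r : ℕ} {m : Fin ℓ → ℕ}

lemma eval_iterate_derivative_weight_mul (q : ℝ[X]) {s : ℕ} (hs : s < r) :
    (derivative^[s] (weight r * q)).eval 0 = 0 ∧ (derivative^[s] (weight r * q)).eval 1 = 0 := by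
  have h0 : (X : ℝ[X]) ^ r ∣ weight r * q := ⟨(1 - X) ^ r * q, by rw [weight]; ring⟩
  have h1 : (1 - X : ℝ[X]) ^ r ∣ weight r * q := ⟨X ^ r * q, by rw [weight]; ring⟩
  obtain ⟨p0, hp0⟩ := pow_sub_dvd_iterate_derivative_of_pow_dvd s h0
  obtain ⟨p1, hp1⟩ := pow_sub_dvd_iterate_derivative_of_pow_dvd s h1
  have hne : r - s ≠ 0 := by omega
  exact ⟨by rw [hp0]; simp [hne], by rw [hp1]; simp [hne]⟩

lemma natDegree_weight_mul_le {q : ℝ[X]} {D : ℕ} (hq : q.natDegree ≤ D) :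
    (weight r * q).natDegree ≤ 2 * r + D := by
  refine natDegree_mul_le_of_le (natDegree_mul_le_of_le (natDegree_X_pow_le r)
    (natDegree_pow_le_of_le r (m := 1) ?_) |>.trans ?_) hq
  · exact (natDegree_sub_le _ _).trans (by simp)
  · omega

/-- Velocities of degree `r` integrate to pieces of degree `r + 1`, which is where entries of size
`r + 1` are needed. -/
lemma sigSet_compactSplines_subset (hℓ : 0 < ℓ) (hm : ∀ i, r + 1 ≤ m i) {n : ℕ} (hn : n ≤ ℓ) :
    sigSet k (compactSplines d r n : Set (ℕ → Fin d → ℝ[X])) 1 n ⊆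
      sigSet k (splineVelocities d r m paramFactors) (1 / (ℓ : ℝ)) ℓ := by
  rintro x ⟨v, hv, rfl⟩
  rw [← node_compactSplines hn hv]
  refine complexify_node_mem hℓ (fun i a => ?_) hv.2.2.2
  exact (Nat.succ_le_succ (hv.1 i a)).trans (hm i)

/-- Only the piece `i₀` moves; the zeros of order `r` of the weight make it fit its resting
neighbours. -/
lemma sigSet_weightedVelocities_subset (hm : ∀ i, r + 1 ≤ m i) {D : ℕ} (i₀ : Fin ℓ)
    (hi₀ : 2 * r + D + 1 ≤ m i₀) :
    sigSet k (weightedVelocities d r D : Set (ℕ → Fin d → ℝ[X])) 1 1 ⊆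
      sigSet k (splineVelocities d r m paramFactors) (1 / (ℓ : ℝ)) ℓ := by
  rintro x ⟨v, ⟨q, hq, hv⟩, rfl⟩
  let w : ℕ → Fin d → ℝ[X] := fun i => if i = (i₀ : ℕ) then v 0 else 0
  have hw0 : ∀ i : ℕ, i ≠ i₀ → w i = 0 := fun i hi => if_neg hi
  have hnode : node w 1 ℓ = node v 1 1 := by
    rw [node_eq_of_zero (n := i₀ + 1) 1 i₀.2 fun i hi _ => hw0 i (by omega)]
    simp only [node]
    rw [node_eq_of_zero (n := 0) 1 (Nat.zero_le _) fun i _ hi => hw0 i (by omega)]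
    simp [w, node]
  rw [← hnode]
  have hwa : ∀ i a, w i a = 0 ∨ w i a = weight r * q a := by
    intro i a
    by_cases hi : i = (i₀ : ℕ)
    · right
      simp [w, hi, hv]
    · left
      rw [hw0 i hi]
      rfl
  refine complexify_node_mem (i₀.pos) (fun i a => ?_) fun i a s hs => ?_
  · by_cases hi : i = i₀
    · subst hi
      simp only [w, if_true, hv]
      exact (Nat.succ_le_succ (natDegree_weight_mul_le (hq a))).trans hi₀
    · rw [hw0 i fun h => hi (Fin.ext h)]
      simpa using (Nat.le_add_left 1 r).trans (hm i)
  · have h := eval_iterate_derivative_weight_mul (r := r) (q a) hs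
    rcases hwa i a with h1 | h1 <;> rcases hwa (i + 1) a with h2 | h2 <;> rw [h1, h2] <;>
      simp [h.1, h.2]

/-- If the total degree is large, then polynomials vanishing on the signatures of all parametric
splines vanish on the free nilpotent group. -/
theorem exists_eval_eq_zero_of_splines (d k r : ℕ) : ∃ N : ℕ, ∀ (M ℓ : ℕ) (m : Fin ℓ → ℕ),
    IsCompGE (r + 1) M m → N ≤ M → ∀ F : MvPolynomial (TruncWord d k) ℂ,
    (∀ x ∈ sigSet k (splineVelocities d r m paramFactors) (1 / (ℓ : ℝ)) ℓ,
      MvPolynomial.eval x F = 0) →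
    ∀ x ∈ freeNilpotentGroup ℂ d k, MvPolynomial.eval x F = 0 := by
  obtain ⟨n, hn⟩ := exists_compactSplines d k r
  obtain ⟨D, hD⟩ := exists_weightedVelocities d k r
  -- Pigeonhole: fewer than `n` entries, all below `2 * r + D + 1`, cannot sum to this much.
  refine ⟨n * (2 * r + D + 1) + 1, ?_⟩
  rintro M ℓ m ⟨hℓ, hm, hM⟩ hN F hF
  by_cases h : n ≤ ℓ
  · exact hn F fun x hx => hF x (sigSet_compactSplines_subset hℓ hm h hx)
  · obtain ⟨i₀, hi₀⟩ : ∃ i₀, 2 * r + D + 1 ≤ m i₀ := by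
      by_contra! hcon
      have h1 : ∑ i, m i ≤ ∑ _i : Fin ℓ, (2 * r + D + 1) := sum_le_sum fun i _ => (hcon i).le
      rw [sum_const, card_univ, Fintype.card_fin, smul_eq_mul, hM] at h1
      have h2 : ℓ * (2 * r + D + 1) ≤ n * (2 * r + D + 1) := Nat.mul_le_mul_right _ (by omega)
      omega
    exact hD F fun x hx => hF x (sigSet_weightedVelocities_subset hm i₀ hi₀ hx)

lemma zariskiClosure_sigSet_subset (𝒱 : Set (ℕ → Fin d → ℝ[X])) (h : ℝ) (n : ℕ) :
    zariskiClosure (sigSet k 𝒱 h n) ⊆ freeNilpotentGroup ℂ d k := by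
  intro x hx
  by_contra hcon
  obtain ⟨F, hF, hFx⟩ := TensorAlg.exists_separating_polynomial hcon
  refine hFx (mem_zariskiClosure.1 hx F ?_)
  rintro _ ⟨v, -, rfl⟩
  rw [complexify_node]
  exact eval_node_eq_zero hF _ _ _

theorem splineVarieties_eq (d k r : ℕ) : ∃ N : ℕ, ∀ (M ℓ : ℕ) (m : Fin ℓ → ℕ),
    IsCompGE (r + 1) M m → N ≤ M →
      paramSplineVariety d k r m = freeNilpotentGroup ℂ d k ∧
      geomSplineVariety d k r m = freeNilpotentGroup ℂ d k := by
  obtain ⟨N, hN⟩ := exists_eval_eq_zero_of_splines d k r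
  refine ⟨N, fun M ℓ m hm hM => ?_⟩
  rw [paramSplineVariety_eq k r hm.1, geomSplineVariety_eq k r hm.1]
  have key : ∀ x ∈ freeNilpotentGroup ℂ d k, ∀ F : MvPolynomial (TruncWord d k) ℂ,
      (∀ y ∈ sigSet k (splineVelocities d r m paramFactors) (1 / (ℓ : ℝ)) ℓ,
        MvPolynomial.eval y F = 0) → MvPolynomial.eval x F = 0 :=
    fun x hx F hF => hN M ℓ m hm hM F hF x hx
  have hsub : sigSet k (splineVelocities d r m paramFactors) (1 / (ℓ : ℝ)) ℓ ⊆
      sigSet k (splineVelocities d r m geomFactors) (1 / (ℓ : ℝ)) ℓ := by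
    refine sigSet_mono ?_ _ _
    rintro v ⟨ρ, hρ, h⟩
    exact ⟨ρ, paramFactors_subset_geomFactors hρ, h⟩
  refine ⟨(zariskiClosure_sigSet_subset _ _ _).antisymm fun x hx => mem_zariskiClosure.2 (key x hx),
    (zariskiClosure_sigSet_subset _ _ _).antisymm fun x hx => mem_zariskiClosure.2 fun F hF =>
      key x hx F fun y hy => hF y (hsub hy)⟩

end LargeDegree

end

theorem mainTheorem6 :
    (∀ (d k r M ℓ : ℕ) (m : Fin ℓ → ℕ), IsCompGE r M m →
      IsZariskiIrreducible (paramSplineVariety d k r m) ∧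
      IsZariskiIrreducible (geomSplineVariety d k r m)) ∧
    (∀ d k r : ℕ, ∃ N : ℕ, ∀ (M ℓ : ℕ) (m : Fin ℓ → ℕ), IsCompGE (r + 1) M m → N ≤ M →
      paramSplineVariety d k r m = freeNilpotentGroup ℂ d k ∧
      geomSplineVariety d k r m = freeNilpotentGroup ℂ d k) := by
  refine ⟨?_, splineVarieties_eq⟩
  rintro d k r M ℓ m ⟨hℓ, hm, -⟩
  exact ⟨isZariskiIrreducible_paramSplineVariety hℓ hm,
    isZariskiIrreducible_geomSplineVariety hℓ hm⟩
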